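/- Let $\mathrm{Ai}$, $\mathrm{Bi}$ be the standard Airy functions (entire solutions of $y''=zy$), let $V_a=a\,\mathrm{Ai}+\mathrm{Bi}$ for $a\in\mathbb{R}$, and put $U_{\pm}=V_{\pm\sqrt3}=\pm\sqrt3\,\mathrm{Ai}+\mathrm{Bi}$. Let $\arg$ take values in $(-\pi,\pi]$. The zeros of $V_a$ and $V_a'=dV_a/dz$ in $\mathbb{C}$ are distributed as follows. - If $a>\sqrt3$, each of $V_a$ and $V_a'$ has infinitely many zeros on the negative real semiaxis, infinitely many zeros in the sector $0<\arg z<\pi/3$, and the complex conjugates of the latter. In addition, $V_a'$ has exactly one zero on the positive semiaxis. There are no other zeros of $V_a$ and $V_a'$. - If $a=\sqrt3$, each of $V_a=U_+$ and $U_+'$ has infinitely many zeros on the negative semiaxis, as well as zeros on the rays $\arg z=\pm\pi/3$, which are exactly the points obtained from its negative zeros by the rotations of the plane through $\mp2\pi/3$. In addition, $U_+'$ has a zero at $z=0$. There are no other zeros of $U_+$ and $U_+'$. - If $-\sqrt3<a<\sqrt3$, each of $V_a$ and $V_a'$ has infinitely many zeros on the negative semiaxis, infinitely many zeros in the sector $\pi/3<\arg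 z<\pi/2$, and the complex conjugates of the latter. There are no other zeros of $V_a$ and $V_a'$. - If $a=-\sqrt3$, each of $V_a=U_-$ and $U_-'$ has infinitely many zeros on the negative semiaxis, as well as zeros on the rays $\arg z=\pm\pi/3$, which are exactly the points obtained from its negative zeros by the rotations of the plane through $\mp2\pi/3$. In addition, $U_-$ has a zero at $z=0$. There are no other zeros of $U_-$ and $U_-'$. - If $a<-\sqrt3$, each of $V_a$ and $V_a'$ has infinitely many zeros on the negative semiaxis, infinitely many zeros in the sector $0<\arg z<\pi/3$, and the complex conjugates of the latter. In addition, $V_a$ has exactly one zero on the positive semiaxis. There are no other zeros of $V_a$ and $V_a'$. For every $a\in\mathbb{R}$, all zeros of $V_a$ and $V_a'$ are simple, except that $U_+'$ has a double zero at $z=0$. For every $a\in\mathbb{R}$, the non-real zeros of $V_a$ and of $V_a'$ approach the rays $\arg z=\pm\pi/3$ at infinity: the distance from a non-real zero $z$ to the ray $\arg z=\pi/3$ (if $\operatorname{Im}z>0$), respectively $\arg z=-\pi/3$ (if $\operatorname{Im}z<0$), tends to $0$ as $|z|\to\infty$. -/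

import Mathlib

noncomputable section

namespace Airy

/-- The entire function `φ₀(z) = ∑ₖ (2 · 5 ⋯ (3k - 1)) / (3k + 1)! · zᵏ`. -/
def phi0 (z : ℂ) : ℂ :=
  ∑' k : ℕ, (∏ s ∈ Finset.range k, ((2 : ℂ) + 3 * s)) / ((1 + 3 * k).factorial : ℂ) * z ^ k

/-- The entire function `φ₁(z) = ∑ₖ (1 · 4 ⋯ (3k - 2)) / (3k)! · zᵏ`. -/
def phi1 (z : ℂ) : ℂ :=
  ∑' k : ℕ, (∏ s ∈ Finset.range k, ((1 : ℂ) + 3 * s)) / ((3 * k).factorial : ℂ) * z ^ k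

theorem phi0_coeff_le (k : ℕ) :
    (∏ s ∈ Finset.range k, (2 + 3 * s)) * k.factorial ≤ (1 + 3 * k).factorial := by
  induction k with
  | zero => simp
  | succ k ih =>
    rw [Finset.prod_range_succ, Nat.factorial_succ k,
      show 1 + 3 * (k + 1) = (1 + 3 * k) + 1 + 1 + 1 by ring, Nat.factorial_succ,
      Nat.factorial_succ, Nat.factorial_succ]
    calc _ = ((2 + 3 * k) * (k + 1)) * ((∏ s ∈ Finset.range k, (2 + 3 * s)) * k.factorial) := by ring
      _ ≤ ((1 + 3 * k + 1 + 1 + 1) * ((1 + 3 * k + 1 + 1) * (1 + 3 * k + 1))) * (1 + 3 * k).factorial := by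
        apply Nat.mul_le_mul _ ih
        nlinarith [Nat.zero_le (k*k), Nat.zero_le (k*k*k), Nat.zero_le k]
      _ = _ := by ring

theorem phi1_coeff_le (k : ℕ) :
    (∏ s ∈ Finset.range k, (1 + 3 * s)) * k.factorial ≤ (3 * k).factorial := by
  induction k with
  | zero => simp
  | succ k ih =>
    rw [Finset.prod_range_succ, Nat.factorial_succ k,
      show 3 * (k + 1) = (3 * k) + 1 + 1 + 1 by ring, Nat.factorial_succ,
      Nat.factorial_succ, Nat.factorial_succ]
    calc _ = ((1 + 3 * k) * (k + 1)) * ((∏ s ∈ Finset.range k, (1 + 3 * s)) * k.factorial) := by ring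
      _ ≤ ((3 * k + 1 + 1 + 1) * ((3 * k + 1 + 1) * (3 * k + 1))) * (3 * k).factorial := by
        apply Nat.mul_le_mul _ ih
        nlinarith [Nat.zero_le (k*k), Nat.zero_le (k*k*k), Nat.zero_le k]
      _ = _ := by ring

theorem summable_coeff (p q : ℕ → ℕ) (hq : ∀ k, 0 < q k) (h : ∀ k, p k * k.factorial ≤ q k) (z : ℂ) :
    Summable fun k : ℕ => (p k : ℂ) / (q k : ℂ) * z ^ k := by
  refine Summable.of_norm_bounded (Real.summable_pow_div_factorial ‖z‖) fun k => ?_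
  rw [norm_mul, norm_div, norm_pow, Complex.norm_natCast, Complex.norm_natCast, div_mul_eq_mul_div,
    div_le_div_iff₀ (by exact_mod_cast hq k) (by exact_mod_cast k.factorial_pos)]
  have : (p k : ℝ) * k.factorial ≤ q k := by exact_mod_cast h k
  nlinarith [pow_nonneg (norm_nonneg z) k, mul_le_mul_of_nonneg_left this (pow_nonneg (norm_nonneg z) k)]

/-- The series of `phi0` converges for all `z`. -/
theorem summable_phi0 (z : ℂ) : Summable fun k : ℕ =>
    (∏ s ∈ Finset.range k, ((2 : ℂ) + 3 * s)) / ((1 + 3 * k).factorial : ℂ) * z ^ k := by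
  simpa using summable_coeff _ _ (fun k => (1 + 3 * k).factorial_pos) phi0_coeff_le z

/-- The series of `phi1` converges for all `z`. -/
theorem summable_phi1 (z : ℂ) : Summable fun k : ℕ =>
    (∏ s ∈ Finset.range k, ((1 : ℂ) + 3 * s)) / ((3 * k).factorial : ℂ) * z ^ k := by
  simpa using summable_coeff _ _ (fun k => (3 * k).factorial_pos) phi1_coeff_le z

/-- The value `Ai(0) = 1 / (3^{2/3} Γ(2/3))`. -/
def ai0 : ℝ := 1 / ((3 : ℝ) ^ (2 / 3 : ℝ) * Real.Gamma (2 / 3))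

/-- The value `Ai'(0) = -1 / (3^{1/3} Γ(1/3))`. -/
def ai0' : ℝ := -(1 / ((3 : ℝ) ^ (1 / 3 : ℝ) * Real.Gamma (1 / 3)))

/-- The value `Bi(0) = 1 / (3^{1/6} Γ(2/3))`. -/
def bi0 : ℝ := 1 / ((3 : ℝ) ^ (1 / 6 : ℝ) * Real.Gamma (2 / 3))

/-- The value `Bi'(0) = 3^{1/6} / Γ(1/3)`. -/
def bi0' : ℝ := (3 : ℝ) ^ (1 / 6 : ℝ) / Real.Gamma (1 / 3)

/-- The Airy function of the first kind on `ℂ`, by its Maclaurin series: `φ₁(z³)` and `z φ₀(z³)`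
are the solutions of `y'' = z y` with initial data `(1, 0)` and `(0, 1)` at `0`. -/
def Ai (z : ℂ) : ℂ := (ai0 : ℂ) * phi1 (z ^ 3) + (ai0' : ℂ) * (z * phi0 (z ^ 3))

/-- The Airy function of the second kind on `ℂ`, by its Maclaurin series. -/
def Bi (z : ℂ) : ℂ := (bi0 : ℂ) * phi1 (z ^ 3) + (bi0' : ℂ) * (z * phi0 (z ^ 3))

/-- The real solutions `V_a = a Ai + Bi` of the Airy equation. -/
def V (a : ℝ) (z : ℂ) : ℂ := (a : ℂ) * Ai z + Bi z

/-- `U₊ = √3 Ai + Bi`. -/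
def Uplus (z : ℂ) : ℂ := (√3 : ℝ) * Ai z + Bi z

/-- `U₋ = -√3 Ai + Bi`. -/
def Uminus (z : ℂ) : ℂ := -(√3 : ℝ) * Ai z + Bi z

/-- The set of complex zeros of `f`. -/
def zeroSet (f : ℂ → ℂ) : Set ℂ := {z | f z = 0}

/-- The zeros of `f` on the (open) negative real semiaxis. -/
def negZeros (f : ℂ → ℂ) : Set ℂ := {z | f z = 0 ∧ z.im = 0 ∧ z.re < 0}

/-- The zeros of `f` in the open sector `α < arg z < β` with vertex `0`. -/
def sectorZeros (f : ℂ → ℂ) (α β : ℝ) : Set ℂ := {z | f z = 0 ∧ z ≠ 0 ∧ z.arg ∈ Set.Ioo α β}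

/-- The zeros of `f` on the open ray `arg z = θ` from `0`. -/
def rayZeros (f : ℂ → ℂ) (θ : ℝ) : Set ℂ := {z | f z = 0 ∧ z ≠ 0 ∧ z.arg = θ}

/-- The rotation of the complex plane about `0` by the angle `θ`. -/
def rot (θ : ℝ) (z : ℂ) : ℂ := Complex.exp (θ * Complex.I) * z

/-- The closed ray from `0` in the direction `exp (iθ)`. -/
def ray (θ : ℝ) : Set ℂ := {z | ∃ r : ℝ, 0 ≤ r ∧ z = r * Complex.exp (θ * Complex.I)}

/-- `f` has infinitely many negative zeros, infinitely many zeros in the sector `α < arg z < β`,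
the conjugates of the latter, the zeros in `E`, and no other zeros. -/
def SectorZeroPattern (f : ℂ → ℂ) (α β : ℝ) (E : Set ℂ) : Prop :=
  (negZeros f).Infinite ∧ (sectorZeros f α β).Infinite ∧
    zeroSet f = negZeros f ∪ sectorZeros f α β ∪ starRingEnd ℂ '' sectorZeros f α β ∪ E

/-- `f` has infinitely many negative zeros, zeros on the rays `arg z = ±π/3` that are exactly the
negative zeros rotated by `∓2π/3`, the zeros in `E`, and no other zeros. -/
def RayZeroPattern (f : ℂ → ℂ) (E : Set ℂ) : Prop :=
  (negZeros f).Infinite ∧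
    rayZeros f (Real.pi / 3) = rot (-(2 * Real.pi / 3)) '' negZeros f ∧
    rayZeros f (-(Real.pi / 3)) = rot (2 * Real.pi / 3) '' negZeros f ∧
    zeroSet f = negZeros f ∪ rayZeros f (Real.pi / 3) ∪ rayZeros f (-(Real.pi / 3)) ∪ E

/-- The non-real zeros of `f` approach the rays `arg z = ±π/3` at infinity: the distance to the
ray in the same half-plane tends to `0`. -/
def NonrealZerosApproachRays (f : ℂ → ℂ) : Prop :=
  ∀ ε > 0, ∃ R : ℝ, ∀ z : ℂ, f z = 0 → R < ‖z‖ →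
    (0 < z.im → Metric.infDist z (ray (Real.pi / 3)) < ε) ∧
    (z.im < 0 → Metric.infDist z (ray (-(Real.pi / 3))) < ε)

end Airy

end

namespace Airy

open Filter Topology

/-! Two mechanisms locate the zeros. The first is a flux identity. If w'' = z w, then along a line z
+ t d the function d · conj(w) · w' has derivative |d|²|w'|² + d²(z + t d)|w|². It vanishes at every
zero of w or w', while at the origin conj(V_a) V_a' = `ai0 * ai0'` · (a² - 3) with `ai0 * ai0'` < 0.
On the ray arg z = θ the imaginary part of the flux is monotone with the sign of sin 3θ. Comparing
its value at 0 with its value at a zero confines the argument of the zero to one side of π/3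
according to the sign of a² - 3, and to π/3 itself when a² = 3. The direction i, followed by
horizontal lines, excludes the second quadrant. On the positive axis the same role is played by (V
V')' = V'² + x V² > 0, which allows at most one zero of V V' on [0, ∞).

The second is a complex phase-amplitude representation near arg z = π/3, which gives infinitude and
asymptotics. With g(u) = w(e^{iπ/3} u) one has g'' = -u g. The integral q = `moment 0`, a multiple
of the product of two oscillating solutions, satisfies q''' + 4u q' + 2q = 0, with first integral 2
q q'' - q'² + 4u q² = 4κ². Then G_± = q g' - (q'/2) g ± iκ g satisfy first order equations, and R =
G_+/G_- satisfies R' = (2iκ/q) R. Zeros of w are the points where R = 1; at zeros of w', R is close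
to -1. Gaussian comparison gives q ≈ (π/u)^{1/2} for |arg u| ≤ π/3. Hence |R| is constant on the
positive axis and decays or grows exponentially away from it, which forces zeros towards the ray.
Meanwhile log R varies by an amount of order √x on a unit disc about x, so a quantitative open
mapping theorem yields zeros arbitrarily far out.

The same factors show that Ai is bounded on [8, ∞): one of its factors vanishes identically and the
other is bounded. As V_0 grows at least linearly, every V_a takes arbitrarily large positive values,
which produces the positive zero when |a| > √3. Negative zeros come from concavity and Rolle. For a
= ±√3 only one of the two Maclaurin series survives, so the zero sets are invariant under rotation
by 2π/3. Simplicity follows from constancy of the Wronskian and V'' = z V. -/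

/-- `w` is an entire solution of the Airy equation `w'' = z w`, and `w'` is its derivative. -/
structure IsAirySolution (w w' : ℂ → ℂ) : Prop where
  hasDerivAt (z : ℂ) : HasDerivAt w (w' z) z
  hasDerivAt_deriv (z : ℂ) : HasDerivAt w' (z * w z) z

theorem IsAirySolution.add {v v' w w' : ℂ → ℂ} (hv : IsAirySolution v v')
    (hw : IsAirySolution w w') : IsAirySolution (fun z => v z + w z) (fun z => v' z + w' z) where
  hasDerivAt z := (hv.hasDerivAt z).add (hw.hasDerivAt z)
  hasDerivAt_deriv z := by
    convert! (hv.hasDerivAt_deriv z).add (hw.hasDerivAt_deriv z) using 1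
    ring

theorem IsAirySolution.const_mul {w w' : ℂ → ℂ} (hw : IsAirySolution w w') (c : ℂ) :
    IsAirySolution (fun z => c * w z) (fun z => c * w' z) where
  hasDerivAt z := (hw.hasDerivAt z).const_mul c
  hasDerivAt_deriv z := by
    convert! (hw.hasDerivAt_deriv z).const_mul c using 1
    ring

theorem IsAirySolution.deriv_eq {w w' : ℂ → ℂ} (hw : IsAirySolution w w') : deriv w = w' :=
  funext fun z => (hw.hasDerivAt z).deriv

/-! ### Termwise differentiation of the Maclaurin series -/

theorem summable_of_le_inv_factorial {b : ℕ → ℂ} (hb : ∀ k, ‖b k‖ ≤ 1 / (k.factorial : ℝ))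
    (z : ℂ) : Summable fun k => b k * z ^ k := by
  refine Summable.of_norm_bounded (Real.summable_pow_div_factorial ‖z‖) fun k => ?_
  rw [norm_mul, norm_pow]
  calc _ ≤ 1 / (k.factorial : ℝ) * ‖z‖ ^ k := by gcongr; exact hb k
    _ = _ := by ring

theorem succ_mul_le_inv_factorial {b : ℕ → ℂ} (hb : ∀ k, ‖b k‖ ≤ 1 / (k.factorial : ℝ)) (k : ℕ) :
    ‖((k : ℂ) + 1) * b (k + 1)‖ ≤ 1 / (k.factorial : ℝ) := by
  have h1 : ‖(k : ℂ) + 1‖ = (k : ℝ) + 1 := by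
    rw [← Nat.cast_succ, Complex.norm_natCast, Nat.cast_succ]
  rw [norm_mul, h1]
  calc _ ≤ ((k : ℝ) + 1) * (1 / ((k + 1).factorial : ℝ)) := by gcongr; exact hb _
    _ = _ := by
      rw [Nat.factorial_succ]
      have := k.factorial_pos
      push_cast
      field_simp

theorem hasDerivAt_tsum_mul_pow {b : ℕ → ℂ} (hb : ∀ k, ‖b k‖ ≤ 1 / (k.factorial : ℝ)) (z : ℂ) :
    HasDerivAt (fun z => ∑' k, b k * z ^ k) (∑' k : ℕ, ((k : ℂ) + 1) * b (k + 1) * z ^ k) z := by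
  set r : ℝ := ‖z‖ + 1 with hr
  have hr0 : 0 ≤ r := by positivity
  have hu : Summable fun n : ℕ => (n : ℝ) / (n.factorial : ℝ) * r ^ (n - 1) := by
    rw [← summable_nat_add_iff 1]
    refine (Real.summable_pow_div_factorial r).congr fun k => ?_
    rw [Nat.factorial_succ]
    have := k.factorial_pos
    push_cast
    field_simp
  have hbd : ∀ (n : ℕ) (y : ℂ), y ∈ Metric.ball (0 : ℂ) r →
      ‖b n * ((n : ℂ) * y ^ (n - 1))‖ ≤ (n : ℝ) / (n.factorial : ℝ) * r ^ (n - 1) := by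
    intro n y hy
    have hy' : ‖y‖ ≤ r := by simpa using (Metric.mem_ball.1 hy).le
    rw [norm_mul, norm_mul, norm_pow, Complex.norm_natCast]
    calc _ ≤ 1 / (n.factorial : ℝ) * ((n : ℝ) * r ^ (n - 1)) := by gcongr; exact hb n
      _ = _ := by ring
  have hz : z ∈ Metric.ball (0 : ℂ) r := by simp [hr]
  have key := hasDerivAt_tsum_of_isPreconnected (g := fun n y => b n * y ^ n)
    (g' := fun n y => b n * ((n : ℂ) * y ^ (n - 1))) (y₀ := 0) hu Metric.isOpen_ball
    (convex_ball (0 : ℂ) r).isPreconnected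
    (fun n y _ => (hasDerivAt_pow n y).const_mul (b n)) hbd
    (by simp [hr]; positivity) (summable_of_le_inv_factorial hb 0) hz
  convert! key using 1
  have hs : Summable fun n : ℕ => b n * ((n : ℂ) * z ^ (n - 1)) :=
    Summable.of_norm_bounded hu fun n => hbd n z hz
  rw [hs.tsum_eq_zero_add]
  simp only [Nat.cast_zero, zero_mul, mul_zero, zero_add, Nat.cast_add, Nat.cast_one,
    Nat.add_sub_cancel]
  exact tsum_congr fun k => by ring

/-- A power series whose coefficients satisfy the recursion
`9 k (k + 1) bₖ₊₁ + c (k + 1) bₖ₊₁ = bₖ` solves `9 z φ'' + c φ' = φ`. -/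
theorem exists_deriv_of_recurrence {b : ℕ → ℂ} (hb : ∀ k, ‖b k‖ ≤ 1 / (k.factorial : ℝ)) (c : ℂ)
    (hrec : ∀ k : ℕ, (9 * k + c) * ((k + 1) * b (k + 1)) = b k) :
    ∃ f' f'' : ℂ → ℂ, (∀ z, HasDerivAt (fun z => ∑' k, b k * z ^ k) (f' z) z) ∧
      (∀ z, HasDerivAt f' (f'' z) z) ∧
      (∀ z, 9 * z * f'' z + c * f' z = ∑' k, b k * z ^ k) := by
  set b1 : ℕ → ℂ := fun k => ((k : ℂ) + 1) * b (k + 1) with hb1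
  have h1 : ∀ k, ‖b1 k‖ ≤ 1 / (k.factorial : ℝ) := succ_mul_le_inv_factorial hb
  set b2 : ℕ → ℂ := fun k => ((k : ℂ) + 1) * b1 (k + 1) with hb2
  have h2 : ∀ k, ‖b2 k‖ ≤ 1 / (k.factorial : ℝ) := succ_mul_le_inv_factorial h1
  refine ⟨fun z => ∑' k, b1 k * z ^ k, fun z => ∑' k, b2 k * z ^ k,
    fun z => hasDerivAt_tsum_mul_pow hb z, fun z => hasDerivAt_tsum_mul_pow h1 z, fun z => ?_⟩
  have s1 := summable_of_le_inv_factorial h1 z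
  have s2 := summable_of_le_inv_factorial h2 z
  have s3 : Summable fun k : ℕ => ((k : ℂ) * b1 k) * z ^ k := by
    rw [← summable_nat_add_iff 1]
    refine (s2.mul_left z).congr fun k => ?_
    simp only [hb2, Nat.cast_add, Nat.cast_one]; ring
  have e : ∑' k : ℕ, ((k : ℂ) * b1 k) * z ^ k = z * ∑' k, b2 k * z ^ k := by
    rw [s3.tsum_eq_zero_add, ← tsum_mul_left]
    simp only [Nat.cast_zero, zero_mul, zero_add, hb2, Nat.cast_add, Nat.cast_one]
    exact tsum_congr fun k => by ring
  rw [mul_assoc, ← e, ← tsum_mul_left, ← tsum_mul_left,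
    ← (s3.mul_left 9).tsum_add (s1.mul_left c)]
  refine tsum_congr fun k => ?_
  rw [← hrec k]
  simp only [hb1]
  ring

theorem norm_coeff_le {p q : ℕ → ℕ} (hq : ∀ k, 0 < q k) (h : ∀ k, p k * k.factorial ≤ q k)
    (k : ℕ) : ‖(p k : ℂ) / (q k : ℂ)‖ ≤ 1 / (k.factorial : ℝ) := by
  rw [norm_div, Complex.norm_natCast, Complex.norm_natCast,
    div_le_div_iff₀ (by exact_mod_cast hq k) (by exact_mod_cast k.factorial_pos), one_mul]
  exact_mod_cast h k

theorem _root_.HasDerivAt.comp_cube {f : ℂ → ℂ} {f' z : ℂ} (h : HasDerivAt f f' (z ^ 3)) :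
    HasDerivAt (fun z => f (z ^ 3)) (f' * (3 * z ^ 2)) z := by
  have := h.comp z (hasDerivAt_pow 3 z)
  convert! this using 1

/-- For y = φ(z³) one has y'' = z (9 z³ φ'' + 6 φ'), with φ' and φ'' taken at z³, so the Airy
equation becomes the series recurrence with c = 6. -/
theorem isAirySolution_phi1 :
    IsAirySolution (fun z => phi1 (z ^ 3)) (deriv fun z => phi1 (z ^ 3)) := by
  obtain ⟨f', f'', h1, h2, h3⟩ := exists_deriv_of_recurrence
    (b := fun k : ℕ => (∏ s ∈ Finset.range k, ((1 : ℂ) + 3 * s)) / ((3 * k).factorial : ℂ))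
    (fun k => by simpa using norm_coeff_le (fun k => (3 * k).factorial_pos) phi1_coeff_le k) 6
    (fun k => by
      rw [Finset.prod_range_succ, show 3 * (k + 1) = (3 * k) + 1 + 1 + 1 by ring,
        Nat.factorial_succ, Nat.factorial_succ, Nat.factorial_succ]
      have e0 : ((3 * k).factorial : ℂ) ≠ 0 := by exact_mod_cast (3 * k).factorial_ne_zero
      have e1 : (3 * (k : ℂ) + 1) ≠ 0 := by exact_mod_cast (3 * k).succ_ne_zero
      have e2 : (3 * (k : ℂ) + 2) ≠ 0 := by exact_mod_cast (3 * k + 1).succ_ne_zero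
      have e3 : ((k : ℂ) + 1) ≠ 0 := by exact_mod_cast k.succ_ne_zero
      push_cast
      rw [show (3 * (k : ℂ) + 2 + 1) = 3 * (k + 1) by ring,
        show (3 * (k : ℂ) + 1 + 1) = 3 * k + 2 by ring,
        show (1 + 3 * (k : ℂ)) = 3 * k + 1 by ring, show (9 * (k : ℂ) + 6) = 3 * (3 * k + 2) by ring]
      field_simp)
  have d1 : ∀ z : ℂ, HasDerivAt (fun z => phi1 (z ^ 3)) (f' (z ^ 3) * (3 * z ^ 2)) z := fun z =>
    HasDerivAt.comp_cube (f := phi1) (h1 (z ^ 3))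
  have d2 : (deriv fun z => phi1 (z ^ 3)) = fun z => f' (z ^ 3) * (3 * z ^ 2) :=
    funext fun z => (d1 z).deriv
  refine ⟨fun z => by rw [d2]; exact d1 z, fun z => ?_⟩
  rw [d2]
  have := ((h2 (z ^ 3)).comp z (hasDerivAt_pow 3 z)).mul ((hasDerivAt_pow 2 z).const_mul 3)
  convert! this using 1
  rw [phi1, ← h3 (z ^ 3)]
  simp only [Function.comp_apply]
  push_cast
  ring

/-- For y = z φ(z³) one has y'' = z² (9 z³ φ'' + 12 φ'), hence the recurrence is needed with c = 12.
-/
theorem isAirySolution_phi0 :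
    IsAirySolution (fun z => z * phi0 (z ^ 3)) (deriv fun z => z * phi0 (z ^ 3)) := by
  obtain ⟨f', f'', h1, h2, h3⟩ := exists_deriv_of_recurrence
    (b := fun k : ℕ => (∏ s ∈ Finset.range k, ((2 : ℂ) + 3 * s)) / ((1 + 3 * k).factorial : ℂ))
    (fun k => by simpa using norm_coeff_le (fun k => (1 + 3 * k).factorial_pos) phi0_coeff_le k) 12
    (fun k => by
      rw [Finset.prod_range_succ, show 1 + 3 * (k + 1) = (1 + 3 * k) + 1 + 1 + 1 by ring,
        Nat.factorial_succ, Nat.factorial_succ, Nat.factorial_succ]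
      have e0 : ((1 + 3 * k).factorial : ℂ) ≠ 0 := by exact_mod_cast (1 + 3 * k).factorial_ne_zero
      have e1 : (3 * (k : ℂ) + 2) ≠ 0 := by exact_mod_cast (3 * k + 1).succ_ne_zero
      have e2 : ((k : ℂ) + 1) ≠ 0 := by exact_mod_cast k.succ_ne_zero
      have e3 : (3 * (k : ℂ) + 4) ≠ 0 := by exact_mod_cast (3 * k + 3).succ_ne_zero
      push_cast
      rw [show (1 + 3 * (k : ℂ) + 2 + 1) = 3 * k + 4 by ring,
        show (1 + 3 * (k : ℂ) + 1 + 1) = 3 * (k + 1) by ring,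
        show (1 + 3 * (k : ℂ) + 1) = 3 * k + 2 by ring,
        show (2 + 3 * (k : ℂ)) = 3 * k + 2 by ring, show (9 * (k : ℂ) + 12) = 3 * (3 * k + 4) by ring]
      field_simp)
  have d0 : ∀ z : ℂ, HasDerivAt (fun z => phi0 (z ^ 3)) (f' (z ^ 3) * (3 * z ^ 2)) z := fun z =>
    HasDerivAt.comp_cube (f := phi0) (h1 (z ^ 3))
  have d1 : ∀ z : ℂ, HasDerivAt (fun z => z * phi0 (z ^ 3))
      (phi0 (z ^ 3) + z * (f' (z ^ 3) * (3 * z ^ 2))) z := fun z => by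
    convert! (hasDerivAt_id z).mul (d0 z) using 1
    simp
  have d2 : (deriv fun z => z * phi0 (z ^ 3)) =
      fun z => phi0 (z ^ 3) + z * (f' (z ^ 3) * (3 * z ^ 2)) :=
    funext fun z => (d1 z).deriv
  refine ⟨fun z => by rw [d2]; exact d1 z, fun z => ?_⟩
  rw [d2]
  have := (d0 z).add ((hasDerivAt_id z).mul
    (((h2 (z ^ 3)).comp z (hasDerivAt_pow 3 z)).mul ((hasDerivAt_pow 2 z).const_mul 3)))
  convert! this using 1
  have h := h3 (z ^ 3)
  rw [← phi0] at h
  rw [← h]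
  simp only [Function.comp_apply, Pi.mul_apply, id]
  push_cast
  ring

theorem phi1_zero : phi1 0 = 1 := by
  rw [phi1, tsum_eq_single 0 (fun k hk => by simp [hk])]
  simp

theorem phi0_zero : phi0 0 = 1 := by
  rw [phi0, tsum_eq_single 0 (fun k hk => by simp [hk])]
  simp

theorem differentiable_phi1 : Differentiable ℂ phi1 := fun z =>
  (hasDerivAt_tsum_mul_pow (b := fun k : ℕ =>
    (∏ s ∈ Finset.range k, ((1 : ℂ) + 3 * s)) / ((3 * k).factorial : ℂ))
    (fun k => by simpa using norm_coeff_le (fun k => (3 * k).factorial_pos) phi1_coeff_le k)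
    z).differentiableAt

theorem differentiable_phi0 : Differentiable ℂ phi0 := fun z =>
  (hasDerivAt_tsum_mul_pow (b := fun k : ℕ =>
    (∏ s ∈ Finset.range k, ((2 : ℂ) + 3 * s)) / ((1 + 3 * k).factorial : ℂ))
    (fun k => by simpa using norm_coeff_le (fun k => (1 + 3 * k).factorial_pos) phi0_coeff_le k)
    z).differentiableAt

theorem deriv_phi1_cube_zero : deriv (fun z => phi1 (z ^ 3)) 0 = 0 := by
  simpa using ((differentiable_phi1 ((0 : ℂ) ^ 3)).hasDerivAt.comp_cube).deriv

theorem deriv_mul_phi0_cube_zero : deriv (fun z => z * phi0 (z ^ 3)) 0 = 1 := by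
  have h := (differentiable_phi0 ((0 : ℂ) ^ 3)).hasDerivAt.comp_cube
  have := ((hasDerivAt_id (0 : ℂ)).mul h).deriv
  simpa [phi0_zero, Pi.mul_def] using this

theorem phi1_conj (z : ℂ) : phi1 (starRingEnd ℂ z) = starRingEnd ℂ (phi1 z) := by
  rw [phi1, phi1, Complex.conj_tsum]
  exact tsum_congr fun k => by simp [map_ofNat]

theorem phi0_conj (z : ℂ) : phi0 (starRingEnd ℂ z) = starRingEnd ℂ (phi0 z) := by
  rw [phi0, phi0, Complex.conj_tsum]
  exact tsum_congr fun k => by simp [map_ofNat]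

/-! ### Initial values and conjugation symmetry of the real solutions -/

theorem ai0_pos : 0 < ai0 := by
  have := Real.Gamma_pos_of_pos (show (0 : ℝ) < 2 / 3 by norm_num)
  unfold ai0; positivity

theorem ai0'_neg : ai0' < 0 := by
  have := Real.Gamma_pos_of_pos (show (0 : ℝ) < 1 / 3 by norm_num)
  unfold ai0'
  exact neg_neg_of_pos (by positivity)

theorem bi0_eq : bi0 = √3 * ai0 := by
  have h := Real.Gamma_pos_of_pos (show (0 : ℝ) < 2 / 3 by norm_num)
  have e : (3 : ℝ) ^ (2 / 3 : ℝ) = √3 * (3 : ℝ) ^ (1 / 6 : ℝ) := by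
    rw [Real.sqrt_eq_rpow, ← Real.rpow_add (by norm_num)]; norm_num
  have h3 : 0 < √(3 : ℝ) := by positivity
  have h6 : 0 < (3 : ℝ) ^ (1 / 6 : ℝ) := by positivity
  unfold bi0 ai0
  rw [e]
  field_simp

theorem bi0'_eq : bi0' = -(√3 * ai0') := by
  have h := Real.Gamma_pos_of_pos (show (0 : ℝ) < 1 / 3 by norm_num)
  have e : √3 = (3 : ℝ) ^ (1 / 6 : ℝ) * (3 : ℝ) ^ (1 / 3 : ℝ) := by
    rw [Real.sqrt_eq_rpow, ← Real.rpow_add (by norm_num)]; norm_num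
  have h3 : 0 < (3 : ℝ) ^ (1 / 3 : ℝ) := by positivity
  unfold bi0' ai0'
  rw [e]
  field_simp

theorem V_eq (a : ℝ) : V a = fun z => ((a * ai0 + bi0 : ℝ) : ℂ) * phi1 (z ^ 3) +
    ((a * ai0' + bi0' : ℝ) : ℂ) * (z * phi0 (z ^ 3)) := by
  funext z
  simp only [V, Ai, Bi]
  push_cast
  ring

theorem isAirySolution_V (a : ℝ) : IsAirySolution (V a) (deriv (V a)) := by
  have h := (isAirySolution_phi1.const_mul ((a * ai0 + bi0 : ℝ) : ℂ)).add
    (isAirySolution_phi0.const_mul ((a * ai0' + bi0' : ℝ) : ℂ))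
  rw [← V_eq] at h
  rwa [h.deriv_eq]

theorem V_zero (a : ℝ) : V a 0 = ((ai0 * (a + √3) : ℝ) : ℂ) := by
  rw [V_eq, bi0_eq]
  simp [phi1_zero]
  ring

theorem deriv_V_zero (a : ℝ) : deriv (V a) 0 = ((ai0' * (a - √3) : ℝ) : ℂ) := by
  have h := (isAirySolution_phi1.const_mul ((a * ai0 + bi0 : ℝ) : ℂ)).add
    (isAirySolution_phi0.const_mul ((a * ai0' + bi0' : ℝ) : ℂ))
  rw [← V_eq] at h
  rw [h.deriv_eq]
  beta_reduce
  rw [deriv_phi1_cube_zero, deriv_mul_phi0_cube_zero, bi0'_eq]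
  push_cast
  ring

theorem V_conj (a : ℝ) (z : ℂ) : V a (starRingEnd ℂ z) = starRingEnd ℂ (V a z) := by
  simp only [V_eq, ← map_pow, phi1_conj, phi0_conj, map_add, map_mul, Complex.conj_ofReal]

theorem deriv_V_conj (a : ℝ) (z : ℂ) :
    deriv (V a) (starRingEnd ℂ z) = starRingEnd ℂ (deriv (V a) z) := by
  have h : (starRingEnd ℂ ∘ V a ∘ starRingEnd ℂ) = V a := by
    funext z; simp [V_conj]
  have := ((isAirySolution_V a).hasDerivAt (starRingEnd ℂ z)).conj_conj
  rw [h, Complex.conj_conj] at this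
  rw [this.deriv, Complex.conj_conj]

theorem V_ofReal_im (a x : ℝ) : (V a x).im = 0 := by
  have := V_conj a x
  rw [Complex.conj_ofReal] at this
  exact Complex.conj_eq_iff_im.1 this.symm

theorem deriv_V_ofReal_im (a x : ℝ) : (deriv (V a) x).im = 0 := by
  have := deriv_V_conj a x
  rw [Complex.conj_ofReal] at this
  exact Complex.conj_eq_iff_im.1 this.symm

/-! ### Monotone fluxes and the location of the non-real zeros -/

open Set

/-- A monotone function with equal end values is constant, so its derivative could not be nonzero
anywhere inside. -/
theorem lt_of_hasDerivAt_nonneg {f f' : ℝ → ℝ} (hf : ∀ s, HasDerivAt f (f' s) s) {L : ℝ}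
    (hL : 0 < L) (h : ∀ s ∈ Ioo 0 L, 0 ≤ f' s) (hne : ∃ s ∈ Ioo 0 L, f' s ≠ 0) : f 0 < f L := by
  have hmono : MonotoneOn f (Icc 0 L) := by
    refine monotoneOn_of_deriv_nonneg (convex_Icc 0 L)
      (fun s _ => (hf s).continuousAt.continuousWithinAt)
      (fun s _ => (hf s).differentiableAt.differentiableWithinAt) fun s hs => ?_
    rw [interior_Icc] at hs
    rw [(hf s).deriv]
    exact h s hs
  have h0 : (0 : ℝ) ∈ Icc 0 L := ⟨le_rfl, hL.le⟩
  have h1 : L ∈ Icc 0 L := ⟨hL.le, le_rfl⟩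
  refine lt_of_le_of_ne (hmono h0 h1 hL.le) fun heq => ?_
  obtain ⟨s, hs, hne⟩ := hne
  have hev : f =ᶠ[𝓝 s] fun _ => f 0 := by
    filter_upwards [Ioo_mem_nhds hs.1 hs.2] with t ht
    have ht' : t ∈ Icc 0 L := ⟨ht.1.le, ht.2.le⟩
    exact le_antisymm (heq ▸ hmono ht' h1 ht.2.le) (hmono h0 ht' ht.1.le)
  exact hne ((hf s).unique ((hasDerivAt_const s (f 0)).congr_of_eventuallyEq hev))

/-- Supplies strictness in the flux inequalities when the relevant factor happens to vanish at the
midpoint: its derivative does not, so it is nonzero elsewhere on the interval. -/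
theorem exists_ne_zero_of_hasDerivAt {f : ℝ → ℂ} {f' : ℂ} {L : ℝ} (hL : 0 < L)
    (hf : HasDerivAt f f' (L / 2)) (hf' : f' ≠ 0) : ∃ s ∈ Ioo 0 L, f s ≠ 0 := by
  by_contra! hcon
  have hev : f =ᶠ[𝓝 (L / 2)] fun _ => 0 := by
    filter_upwards [Ioo_mem_nhds (show 0 < L / 2 by linarith) (show L / 2 < L by linarith)]
      with t ht using hcon t ht
  exact hf' (hf.unique ((hasDerivAt_const _ (0 : ℂ)).congr_of_eventuallyEq hev))

theorem hasDerivAt_comp_line {f : ℂ → ℂ} {f' z d : ℂ} {s : ℝ} (hf : HasDerivAt f f' (z + s * d)) :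
    HasDerivAt (fun t : ℝ => f (z + t * d)) (f' * d) s := by
  have hl : HasDerivAt (fun t : ℝ => z + (t : ℂ) * d) d s := by
    simpa using ((Complex.ofRealCLM.hasDerivAt (x := s)).mul_const d).const_add z
  exact hf.comp s hl

namespace IsAirySolution

variable {v v' w w' : ℂ → ℂ}

theorem wronskian_eq (hv : IsAirySolution v v') (hw : IsAirySolution w w') (z : ℂ) :
    v z * w' z - v' z * w z = v 0 * w' 0 - v' 0 * w 0 := by
  have h : ∀ z, HasDerivAt (fun z => v z * w' z - v' z * w z) 0 z := fun z => by
    convert! ((hv.hasDerivAt z).mul (hw.hasDerivAt_deriv z)).sub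
      ((hv.hasDerivAt_deriv z).mul (hw.hasDerivAt z)) using 1
    ring
  exact is_const_of_deriv_eq_zero (fun z => (h z).differentiableAt) (fun z => (h z).deriv) z 0

/-- The term |d|²|w'|² is real, so the imaginary part of the derivative has the sign of Im(d²(z + s
d)), which depends only on the line and not on the solution. -/
theorem hasDerivAt_flux (hw : IsAirySolution w w') (z d : ℂ) (s : ℝ) :
    HasDerivAt (fun t : ℝ => d * starRingEnd ℂ (w (z + t * d)) * w' (z + t * d))
      ((‖d‖ ^ 2 * ‖w' (z + s * d)‖ ^ 2 : ℝ) +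
        d ^ 2 * (z + s * d) * (‖w (z + s * d)‖ ^ 2 : ℝ)) s := by
  have h1 := (hasDerivAt_comp_line (s := s) (hw.hasDerivAt (z + s * d))).star.const_mul d
  have h2 := hasDerivAt_comp_line (s := s) (hw.hasDerivAt_deriv (z + s * d))
  convert! h1.mul h2 using 1
  rw [Complex.ofReal_mul, Complex.ofReal_pow, Complex.ofReal_pow, Complex.ofReal_pow,
    ← Complex.conj_mul', ← Complex.conj_mul', ← Complex.conj_mul']
  simp only [Complex.star_def, map_mul]
  ring

theorem hasDerivAt_im_flux (hw : IsAirySolution w w') (z d : ℂ) (s : ℝ) :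
    HasDerivAt (fun t : ℝ => (d * starRingEnd ℂ (w (z + t * d)) * w' (z + t * d)).im)
      ((d ^ 2 * (z + s * d)).im * ‖w (z + s * d)‖ ^ 2) s := by
  have := Complex.imCLM.hasFDerivAt.comp_hasDerivAt s (hw.hasDerivAt_flux z d s)
  convert! this using 1
  simp only [Complex.imCLM_apply, Complex.add_im, Complex.ofReal_im, Complex.im_mul_ofReal,
    zero_add]

theorem im_flux_lt (hw : IsAirySolution w w') (hn : ∀ z, w z = 0 → w' z ≠ 0) (z d : ℂ) (σ : ℝ)
    {L : ℝ} (hL : 0 < L) (h : ∀ s ∈ Ioo 0 L, 0 < σ * (d ^ 2 * (z + s * d)).im) :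
    σ * (d * starRingEnd ℂ (w z) * w' z).im <
      σ * (d * starRingEnd ℂ (w (z + L * d)) * w' (z + L * d)).im := by
  have hd : d ≠ 0 := by
    rintro rfl
    simpa using h (L / 2) ⟨by linarith, by linarith⟩
  have key := lt_of_hasDerivAt_nonneg (fun s => (hw.hasDerivAt_im_flux z d s).const_mul σ) hL
    (fun s hs => by have := (h s hs).le; rw [← mul_assoc]; positivity) ?_
  · simpa using key
  have : ∃ s ∈ Ioo 0 L, w (z + s * d) ≠ 0 := by
    by_cases h0 : w (z + (L / 2 : ℝ) * d) = 0
    · exact exists_ne_zero_of_hasDerivAt hL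
        (hasDerivAt_comp_line (hw.hasDerivAt (z + (L / 2 : ℝ) * d))) (mul_ne_zero (hn _ h0) hd)
    · exact ⟨L / 2, ⟨by linarith, by linarith⟩, h0⟩
  obtain ⟨s, hs, hne⟩ := this
  refine ⟨s, hs, ?_⟩
  have := h s hs
  rw [← mul_assoc]
  positivity

theorem im_flux_eq (hw : IsAirySolution w w') (z d : ℂ) (h : ∀ s : ℝ, (d ^ 2 * (z + s * d)).im = 0)
    (L : ℝ) : (d * starRingEnd ℂ (w (z + L * d)) * w' (z + L * d)).im =
      (d * starRingEnd ℂ (w z) * w' z).im := by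
  have key := is_const_of_deriv_eq_zero
    (fun s => (hw.hasDerivAt_im_flux z d s).differentiableAt)
    (fun s => by rw [(hw.hasDerivAt_im_flux z d s).deriv, h s, zero_mul]) L 0
  simpa using key

/-- For d = i starting at 0, d²(s d) is purely imaginary, so the real part of the flux has
derivative |w'|². That real part is -Im(conj(w) w'). -/
theorem im_conj_mul_lt_of_imaginary (hw : IsAirySolution w w') (hn : ∀ z, w z = 0 → w' z ≠ 0)
    {t : ℝ} (ht : 0 < t) :
    (starRingEnd ℂ (w (t * Complex.I)) * w' (t * Complex.I)).im <
      (starRingEnd ℂ (w 0) * w' 0).im := by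
  have hd : ∀ s : ℝ, HasDerivAt (fun t : ℝ => (Complex.I * starRingEnd ℂ (w (0 + t * Complex.I)) *
      w' (0 + t * Complex.I)).re) (‖w' (0 + s * Complex.I)‖ ^ 2) s := by
    intro s
    have := Complex.reCLM.hasFDerivAt.comp_hasDerivAt s (hw.hasDerivAt_flux 0 Complex.I s)
    convert! this using 1
    simp only [Complex.reCLM_apply, Complex.add_re, Complex.ofReal_re, Complex.re_mul_ofReal]
    simp
  have key := lt_of_hasDerivAt_nonneg hd ht (fun s _ => by positivity) ?_
  · simp only [zero_add, Complex.ofReal_zero, zero_mul, mul_assoc, Complex.I_mul_re] at key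
    linarith
  have : ∃ s ∈ Ioo 0 t, w' (0 + s * Complex.I) ≠ 0 := by
    -- If w' vanishes at the midpoint, then w'' = z w does not vanish there.
    by_cases h0 : w' (0 + (t / 2 : ℝ) * Complex.I) = 0
    · refine exists_ne_zero_of_hasDerivAt ht
        (hasDerivAt_comp_line (hw.hasDerivAt_deriv (0 + (t / 2 : ℝ) * Complex.I))) ?_
      refine mul_ne_zero (mul_ne_zero ?_ fun h => hn _ h h0) Complex.I_ne_zero
      simp [ht.ne']
    · exact ⟨t / 2, ⟨by linarith, by linarith⟩, h0⟩
  obtain ⟨s, hs, hne⟩ := this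
  exact ⟨s, hs, by positivity⟩

end IsAirySolution

/-- A common zero of V_a and V_a' would make the Wronskian of V_a and V_{a+1} vanish, but evaluation
at 0 gives 2√3 · `ai0 * ai0'` ≠ 0. -/
theorem deriv_V_ne_zero {a : ℝ} {z : ℂ} (h : V a z = 0) : deriv (V a) z ≠ 0 := by
  intro h'
  have := (isAirySolution_V a).wronskian_eq (isAirySolution_V (a + 1)) z
  rw [h, h', V_zero, V_zero, deriv_V_zero, deriv_V_zero, zero_mul, zero_mul, sub_zero] at this
  have e : 2 * √3 * (ai0 * ai0') = 0 := by
    have h2 : (0 : ℂ) = ((2 * √3 * (ai0 * ai0') : ℝ) : ℂ) := by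
      rw [this]; push_cast; ring
    exact_mod_cast h2.symm
  have h3 : 0 < √(3 : ℝ) := by positivity
  have := ai0_pos.ne'
  have := ai0'_neg.ne
  simp_all

theorem V_mul_deriv_zero (a : ℝ) :
    starRingEnd ℂ (V a 0) * deriv (V a) 0 = ((ai0 * ai0' * (a ^ 2 - 3) : ℝ) : ℂ) := by
  rw [V_zero, deriv_V_zero, Complex.conj_ofReal, ← Complex.ofReal_mul]
  congr 1
  have : √(3 : ℝ) * √3 = 3 := Real.mul_self_sqrt (by norm_num)
  linear_combination -(ai0 * ai0') * this

theorem ai0_mul_ai0'_neg : ai0 * ai0' < 0 := mul_neg_of_pos_of_neg ai0_pos ai0'_neg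

theorem conj_V_mul_deriv_eq_zero {a : ℝ} {z : ℂ} (h : V a z = 0 ∨ deriv (V a) z = 0) :
    starRingEnd ℂ (V a z) * deriv (V a) z = 0 := by
  rcases h with h | h <;> simp [h]

/-- Since conj(V) V' is real at 0, its imaginary part is negative on the positive imaginary axis.
Moving right from a zero in the second quadrant, the imaginary part increases from 0, so it would be
positive on reaching that axis. -/
theorem re_pos_of_zero {a : ℝ} {z : ℂ} (hz : 0 < z.im) (h : V a z = 0 ∨ deriv (V a) z = 0) :
    0 < z.re := by
  by_contra! hre
  have h0 := conj_V_mul_deriv_eq_zero h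
  have h1 := (isAirySolution_V a).im_conj_mul_lt_of_imaginary (fun z => deriv_V_ne_zero) hz
  rw [V_mul_deriv_zero, Complex.ofReal_im] at h1
  rcases hre.eq_or_lt with hre | hre
  · have : z = z.im * Complex.I := by apply Complex.ext <;> simp [hre]
    rw [← this, h0] at h1
    simp at h1
  · have h2 := (isAirySolution_V a).im_flux_lt (fun z => deriv_V_ne_zero) z 1 1
      (neg_pos.2 hre) (fun s _ => by simpa using hz)
    have e : z + ((-z.re : ℝ) : ℂ) * 1 = z.im * Complex.I := by apply Complex.ext <;> simp
    rw [e, one_mul, one_mul, one_mul, one_mul, h0] at h2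
    simp only [Complex.zero_im] at h2
    linarith

/-! ### The argument of a zero compared with π/3 -/

section Polar

variable {a : ℝ} {z : ℂ}

theorem exp_arg_sq_mul_im (z : ℂ) (s : ℝ) :
    (Complex.exp (z.arg * Complex.I) ^ 2 * (0 + s * Complex.exp (z.arg * Complex.I))).im =
      s * Real.sin (3 * z.arg) := by
  have : Complex.exp (z.arg * Complex.I) ^ 2 * (0 + s * Complex.exp (z.arg * Complex.I)) =
      s * Complex.exp ((3 * z.arg : ℝ) * Complex.I) := by
    rw [show ((3 * z.arg : ℝ) : ℂ) * Complex.I = (3 : ℕ) * (z.arg * Complex.I) by push_cast; ring,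
      Complex.exp_nat_mul]
    ring
  rw [this, Complex.im_ofReal_mul, Complex.exp_ofReal_mul_I_im]

theorem flux_zero_im (a : ℝ) (z : ℂ) : (Complex.exp (z.arg * Complex.I) * starRingEnd ℂ (V a 0) *
    deriv (V a) 0).im = Real.sin z.arg * (ai0 * ai0' * (a ^ 2 - 3)) := by
  rw [mul_assoc, V_mul_deriv_zero, Complex.im_mul_ofReal, Complex.exp_ofReal_mul_I_im]

theorem arg_mem_of_zero (hz : 0 < z.im) (h : V a z = 0 ∨ deriv (V a) z = 0) :
    z.arg ∈ Ioo 0 (Real.pi / 2) := by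
  have hre := re_pos_of_zero hz h
  refine ⟨lt_of_le_of_ne (Complex.arg_nonneg_iff.2 hz.le) fun h0 => ?_, ?_⟩
  · exact hz.ne' (Complex.arg_eq_zero_iff.1 h0.symm).2
  · exact (abs_lt.1 (Complex.abs_arg_lt_pi_div_two_iff.2 (Or.inl hre))).2

theorem norm_mul_exp_arg (z : ℂ) : (0 : ℂ) + ‖z‖ * Complex.exp (z.arg * Complex.I) = z := by
  rw [zero_add, Complex.norm_mul_exp_arg_mul_I]

theorem flux_eq_zero (h : V a z = 0 ∨ deriv (V a) z = 0) (d : ℂ) :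
    (d * starRingEnd ℂ (V a z) * deriv (V a) z).im = 0 := by
  rw [mul_assoc, conj_V_mul_deriv_eq_zero h]; simp

/-- Below π/3 one has sin 3θ > 0, so the flux along the ray increases strictly from a value that is
nonnegative when a² ≤ 3 and cannot be 0 at the zero. -/
theorem pi_div_three_le_arg_of_zero (ha : a ^ 2 ≤ 3) (hz : 0 < z.im)
    (h : V a z = 0 ∨ deriv (V a) z = 0) : Real.pi / 3 ≤ z.arg := by
  by_contra! hlt
  obtain ⟨h0, -⟩ := arg_mem_of_zero hz h
  have hz0 : z ≠ 0 := by rintro rfl; simp at hz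
  have h1 := (isAirySolution_V a).im_flux_lt (fun z => deriv_V_ne_zero) 0
    (Complex.exp (z.arg * Complex.I)) 1 (norm_pos_iff.2 hz0) (fun s hs => by
      rw [exp_arg_sq_mul_im]
      have := Real.sin_pos_of_pos_of_lt_pi (show 0 < 3 * z.arg by linarith) (by linarith)
      have := hs.1
      positivity)
  rw [norm_mul_exp_arg, flux_eq_zero h, flux_zero_im] at h1
  have := Real.sin_pos_of_pos_of_lt_pi h0 (by linarith [Real.pi_pos])
  have := mul_nonneg this.le (mul_nonneg_of_nonpos_of_nonpos ai0_mul_ai0'_neg.le (sub_nonpos.2 ha))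
  linarith

/-- Between π/3 and π/2 one has sin 3θ < 0, so the flux decreases strictly from a value that is
nonpositive when a² ≥ 3. -/
theorem arg_le_pi_div_three_of_zero (ha : 3 ≤ a ^ 2) (hz : 0 < z.im)
    (h : V a z = 0 ∨ deriv (V a) z = 0) : z.arg ≤ Real.pi / 3 := by
  by_contra! hlt
  obtain ⟨h0, h2⟩ := arg_mem_of_zero hz h
  have hz0 : z ≠ 0 := by rintro rfl; simp at hz
  have h1 := (isAirySolution_V a).im_flux_lt (fun z => deriv_V_ne_zero) 0
    (Complex.exp (z.arg * Complex.I)) (-1) (norm_pos_iff.2 hz0) (fun s hs => by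
      rw [exp_arg_sq_mul_im]
      have h3 := Real.sin_pos_of_pos_of_lt_pi (show 0 < 3 * z.arg - Real.pi by linarith)
        (by linarith)
      rw [Real.sin_sub_pi] at h3
      have := mul_pos hs.1 h3
      linarith)
  rw [norm_mul_exp_arg, flux_eq_zero h, flux_zero_im] at h1
  have := Real.sin_pos_of_pos_of_lt_pi h0 (by linarith [Real.pi_pos])
  have := mul_nonneg this.le (mul_nonneg (neg_nonneg.2 ai0_mul_ai0'_neg.le) (sub_nonneg.2 ha))
  linarith

/-- On the ray arg z = π/3 the flux is constant, and its value at 0 is nonzero when a² ≠ 3. -/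
theorem arg_ne_pi_div_three_of_zero (ha : a ^ 2 ≠ 3) (hz : 0 < z.im)
    (h : V a z = 0 ∨ deriv (V a) z = 0) : z.arg ≠ Real.pi / 3 := by
  intro heq
  obtain ⟨h0, h2⟩ := arg_mem_of_zero hz h
  have h1 := (isAirySolution_V a).im_flux_eq 0 (Complex.exp (z.arg * Complex.I)) (fun s => by
      rw [exp_arg_sq_mul_im, heq, mul_div_cancel₀ _ (by norm_num), Real.sin_pi, mul_zero]) ‖z‖
  rw [norm_mul_exp_arg, flux_eq_zero h, flux_zero_im] at h1
  have := Real.sin_pos_of_pos_of_lt_pi h0 (by linarith [Real.pi_pos])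
  have := mul_ne_zero this.ne' (mul_ne_zero ai0_mul_ai0'_neg.ne (sub_ne_zero.2 ha))
  exact this h1.symm

end Polar

/-! ### Multiplicities -/

theorem analyticAt_V (a : ℝ) (z : ℂ) : AnalyticAt ℂ (V a) z :=
  Differentiable.analyticAt (fun z => ((isAirySolution_V a).hasDerivAt z).differentiableAt) z

theorem analyticOrderAt_V {a : ℝ} {z : ℂ} (h : V a z = 0) : analyticOrderAt (V a) z = 1 :=
  (analyticAt_V a z).analyticOrderAt_eq_one_of_zero_deriv_ne_zero h (deriv_V_ne_zero h)

theorem deriv_deriv_V (a : ℝ) : deriv (deriv (V a)) = fun z => z * V a z :=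
  funext fun z => ((isAirySolution_V a).hasDerivAt_deriv z).deriv

theorem V_ne_zero_of_deriv {a : ℝ} {z : ℂ} (h : deriv (V a) z = 0) : V a z ≠ 0 :=
  fun h0 => deriv_V_ne_zero h0 h

theorem deriv_V_zero_eq_zero_iff (a : ℝ) : deriv (V a) 0 = 0 ↔ a = √3 := by
  rw [deriv_V_zero, Complex.ofReal_eq_zero, mul_eq_zero, or_iff_right ai0'_neg.ne, sub_eq_zero]

theorem V_zero_eq_zero_iff (a : ℝ) : V a 0 = 0 ↔ a = -√3 := by
  rw [V_zero, Complex.ofReal_eq_zero, mul_eq_zero, or_iff_right ai0_pos.ne', eq_neg_iff_add_eq_zero]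

theorem analyticOrderAt_deriv_V {a : ℝ} {z : ℂ} (h : deriv (V a) z = 0)
    (hz : ¬(a = √3 ∧ z = 0)) : analyticOrderAt (deriv (V a)) z = 1 := by
  refine (analyticAt_V a z).deriv.analyticOrderAt_eq_one_of_zero_deriv_ne_zero h ?_
  rw [deriv_deriv_V]
  refine mul_ne_zero ?_ (V_ne_zero_of_deriv h)
  rintro rfl
  exact hz ⟨(deriv_V_zero_eq_zero_iff a).1 h, rfl⟩

/-- The second derivative z V has a simple zero at 0 because V does not vanish there; integration
raises the order by one. -/
theorem analyticOrderAt_deriv_V_sqrt_three : analyticOrderAt (deriv (V √3)) 0 = 2 := by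
  have h0 : deriv (V √3) 0 = 0 := (deriv_V_zero_eq_zero_iff _).2 rfl
  have h1 := (analyticAt_V √3 0).deriv.analyticOrderAt_deriv_add_one
  simp only [h0, sub_zero] at h1
  rw [← h1, deriv_deriv_V]
  have h2 : analyticOrderAt (fun z => z * V √3 z) 0 = 1 := by
    refine AnalyticAt.analyticOrderAt_eq_one_of_zero_deriv_ne_zero
      (analyticAt_id.mul (analyticAt_V √3 0)) (by simp) ?_
    have := (hasDerivAt_id (0 : ℂ)).mul ((isAirySolution_V √3).hasDerivAt 0)
    have e : deriv (fun z => z * V √3 z) 0 = V √3 0 := by simpa [Pi.mul_def] using this.deriv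
    rw [e]
    exact V_ne_zero_of_deriv h0
  rw [h2]
  norm_num

/-! ### The modulus function and its moments -/

open MeasureTheory

/-- The moments `∫ s²ʲ exp (-u s² - s⁶ / 12) ds`. The zeroth one is, up to a constant factor, the
modulus function `Ai² + Bi²` at `-u`, the product of the two Airy solutions that are oscillating
for `u > 0`. -/
noncomputable def moment (j : ℕ) (u : ℂ) : ℂ :=
  ∫ s : ℝ, (s : ℂ) ^ (2 * j) * Complex.exp (-u * s ^ 2 - s ^ 6 / 12)

theorem norm_moment_integrand (j : ℕ) (u : ℂ) (s : ℝ) :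
    ‖(s : ℂ) ^ (2 * j) * Complex.exp (-u * s ^ 2 - s ^ 6 / 12)‖ =
      s ^ (2 * j) * Real.exp (-u.re * s ^ 2 - s ^ 6 / 12) := by
  rw [norm_mul, norm_pow, Complex.norm_real, Complex.norm_exp, pow_mul, Real.norm_eq_abs, sq_abs,
    ← pow_mul]
  congr 2
  rw [← Complex.ofReal_pow, ← Complex.ofReal_pow, Complex.sub_re, Complex.re_mul_ofReal,
    Complex.neg_re, show ((s ^ 6 : ℝ) : ℂ) / 12 = ((s ^ 6 / 12 : ℝ) : ℂ) by push_cast; ring,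
    Complex.ofReal_re]

theorem pow_mul_exp_neg_le (j : ℕ) (x : ℝ) (hx : 0 ≤ x) :
    x ^ j * Real.exp (-(2 * x)) ≤ (j.factorial : ℝ) * Real.exp (-x) := by
  have h := Real.pow_div_factorial_le_exp x hx j
  rw [div_le_iff₀ (by exact_mod_cast j.factorial_pos)] at h
  calc x ^ j * Real.exp (-(2 * x)) ≤ (Real.exp x * j.factorial) * Real.exp (-(2 * x)) := by gcongr
    _ = j.factorial * (Real.exp x * Real.exp (-(2 * x))) := by ring
    _ = _ := by rw [← Real.exp_add]; congr 2; ring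

theorem integrable_moment_bound (j : ℕ) {M : ℝ} (hM : 0 ≤ M) :
    Integrable fun s : ℝ => s ^ (2 * j) * Real.exp (M * s ^ 2 - s ^ 6 / 12) := by
  have hg : Integrable fun s : ℝ => (Real.exp (12 * (M + 2) ^ 2) * j.factorial) *
      Real.exp (-1 * s ^ 2) := (integrable_exp_neg_mul_sq one_pos).const_mul _
  refine hg.mono' (by fun_prop) (Eventually.of_forall fun s => ?_)
  have h0 : 0 ≤ s ^ (2 * j) * Real.exp (M * s ^ 2 - s ^ 6 / 12) := by
    rw [pow_mul]; positivity
  rw [Real.norm_of_nonneg h0, pow_mul]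
  set x := s ^ 2 with hx
  have hx0 : 0 ≤ x := sq_nonneg s
  have h6 : s ^ 6 = x ^ 3 := by rw [hx]; ring
  -- With x = s², the cubic term beats (M + 2) x as soon as x ≥ 12 (M + 2); for smaller x, (M + 2) x
  -- is at most 12 (M + 2)². Of the resulting decay exp(-2x), one half absorbs x^j and the other
  -- remains as a Gaussian.
  have hle : M * x - s ^ 6 / 12 ≤ 12 * (M + 2) ^ 2 + -(2 * x) := by
    rw [h6]
    rcases le_total (12 * (M + 2)) x with h | h
    · have : 12 * (M + 2) ≤ x ^ 2 := by nlinarith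
      nlinarith [mul_le_mul_of_nonneg_right this hx0, sq_nonneg (M + 2)]
    · nlinarith [pow_nonneg hx0 3, mul_le_mul_of_nonneg_left h (show 0 ≤ M + 2 by linarith)]
  calc x ^ j * Real.exp (M * x - s ^ 6 / 12)
      ≤ x ^ j * Real.exp (12 * (M + 2) ^ 2 + -(2 * x)) := by gcongr
    _ = Real.exp (12 * (M + 2) ^ 2) * (x ^ j * Real.exp (-(2 * x))) := by
      rw [Real.exp_add]; ring
    _ ≤ Real.exp (12 * (M + 2) ^ 2) * (j.factorial * Real.exp (-x)) :=
      mul_le_mul_of_nonneg_left (pow_mul_exp_neg_le j x hx0) (Real.exp_pos _).le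
    _ = _ := by rw [neg_one_mul]; ring

theorem continuous_moment_integrand (j : ℕ) (u : ℂ) : Continuous fun s : ℝ =>
    (s : ℂ) ^ (2 * j) * Complex.exp (-u * s ^ 2 - s ^ 6 / 12) := by fun_prop

theorem norm_moment_integrand_le (j : ℕ) {u : ℂ} {M : ℝ} (hu : ‖u‖ ≤ M) (s : ℝ) :
    ‖(s : ℂ) ^ (2 * j) * Complex.exp (-u * s ^ 2 - s ^ 6 / 12)‖ ≤
      s ^ (2 * j) * Real.exp (M * s ^ 2 - s ^ 6 / 12) := by
  rw [norm_moment_integrand, pow_mul]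
  have := (neg_le_abs u.re).trans ((Complex.abs_re_le_norm u).trans hu)
  gcongr

theorem integrable_moment (j : ℕ) (u : ℂ) : Integrable fun s : ℝ =>
    (s : ℂ) ^ (2 * j) * Complex.exp (-u * s ^ 2 - s ^ 6 / 12) :=
  (integrable_moment_bound j (norm_nonneg u)).mono'
    (continuous_moment_integrand j u).aestronglyMeasurable
    (Eventually.of_forall (norm_moment_integrand_le j le_rfl))

theorem hasDerivAt_moment (j : ℕ) (u : ℂ) : HasDerivAt (moment j) (-moment (j + 1) u) u := by
  have hM : 0 ≤ ‖u‖ + 1 := by positivity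
  have key := hasDerivAt_integral_of_dominated_loc_of_deriv_le (μ := volume)
    (F := fun (u : ℂ) (s : ℝ) => (s : ℂ) ^ (2 * j) * Complex.exp (-u * s ^ 2 - s ^ 6 / 12))
    (F' := fun (u : ℂ) (s : ℝ) =>
      -((s : ℂ) ^ (2 * (j + 1)) * Complex.exp (-u * s ^ 2 - s ^ 6 / 12)))
    (bound := fun s => s ^ (2 * (j + 1)) * Real.exp ((‖u‖ + 1) * s ^ 2 - s ^ 6 / 12))
    (Metric.ball_mem_nhds u one_pos)
    (Eventually.of_forall fun v => (continuous_moment_integrand j v).aestronglyMeasurable)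
    (integrable_moment j u) (continuous_moment_integrand (j + 1) u).neg.aestronglyMeasurable
    (Eventually.of_forall fun s v hv => ?_) (integrable_moment_bound (j + 1) hM)
    (Eventually.of_forall fun s v _ => ?_)
  · convert! key.2 using 1
    rw [integral_neg, moment]
  · rw [norm_neg]
    refine norm_moment_integrand_le _ ?_ s
    have : ‖v - u‖ < 1 := by rwa [Metric.mem_ball, dist_eq_norm] at hv
    linarith [norm_le_norm_add_norm_sub' v u]
  · have h : HasDerivAt (fun v : ℂ => -v * (s : ℂ) ^ 2 - (s : ℂ) ^ 6 / 12) (-(s : ℂ) ^ 2) v := by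
      simpa using (((hasDerivAt_id v).neg.mul_const ((s : ℂ) ^ 2)).sub_const ((s : ℂ) ^ 6 / 12))
    convert! h.cexp.const_mul ((s : ℂ) ^ (2 * j)) using 1
    ring

theorem differentiable_moment (j : ℕ) : Differentiable ℂ (moment j) :=
  fun u => (hasDerivAt_moment j u).differentiableAt

/-- The integral over ℝ of the derivative of s · exp(-u s² - s⁶/12) is zero. With q = `moment 0` and
q' = -`moment 1` this is q''' + 4u q' + 2q = 0, the equation for products of solutions of g'' = -u
g. -/
theorem moment_recurrence (u : ℂ) : 2 * moment 0 u - 4 * u * moment 1 u - moment 3 u = 0 := by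
  set E : ℝ → ℂ := fun s => Complex.exp (-u * s ^ 2 - s ^ 6 / 12) with hE
  have hd : ∀ s : ℝ, HasDerivAt (fun s : ℝ => (s : ℂ) * E s)
      (E s + s * (E s * (-2 * u * s - s ^ 5 / 2))) s := by
    intro s
    have h1 : HasDerivAt (fun z : ℂ => -u * z ^ 2 - z ^ 6 / 12) (-2 * u * s - s ^ 5 / 2) (s : ℂ) := by
      convert! ((hasDerivAt_pow 2 (s : ℂ)).const_mul (-u)).sub
        ((hasDerivAt_pow 6 (s : ℂ)).div_const 12) using 1
      push_cast; ring
    have h2 := ((hasDerivAt_id (s : ℂ)).mul h1.cexp).comp_ofReal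
    simpa [hE] using! h2
  have i0 := integrable_moment 0 u
  have i1 := integrable_moment 1 u
  have i3 := integrable_moment 3 u
  have hf' : (fun s : ℝ => E s + s * (E s * (-2 * u * s - s ^ 5 / 2))) = fun s : ℝ =>
      ((s : ℂ) ^ (2 * 0) * E s - (2 * u) * ((s : ℂ) ^ (2 * 1) * E s)) -
        (1 / 2) * ((s : ℂ) ^ (2 * 3) * E s) := by
    funext s; ring
  have i01 : Integrable fun s : ℝ =>
      (s : ℂ) ^ (2 * 0) * E s - (2 * u) * ((s : ℂ) ^ (2 * 1) * E s) := i0.sub (i1.const_mul _)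
  have hint : Integrable (fun s : ℝ => E s + s * (E s * (-2 * u * s - s ^ 5 / 2))) := by
    rw [hf']
    exact i01.sub (i3.const_mul _)
  have hf : Integrable (fun s : ℝ => (s : ℂ) * E s) := by
    refine ((i0.norm.add i1.norm)).mono' (by fun_prop) (Eventually.of_forall fun s => ?_)
    simp only [Pi.add_apply, norm_mul, norm_pow, Complex.norm_real, Real.norm_eq_abs]
    rw [← add_mul]
    gcongr
    have := abs_nonneg s
    norm_num
    nlinarith [sq_nonneg (|s| - 1), sq_abs s]
  have key := integral_eq_zero_of_hasDerivAt_of_integrable hd hint hf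
  rw [hf', integral_sub i01 (i3.const_mul _),
    integral_sub i0 (i1.const_mul _), integral_const_mul, integral_const_mul] at key
  simp only [moment]
  linear_combination 2 * key

/-- The conserved quantity of the third order equation satisfied by `moment 0`. -/
theorem moment_invariant (u : ℂ) :
    2 * moment 0 u * moment 2 u - moment 1 u ^ 2 + 4 * u * moment 0 u ^ 2 =
      2 * moment 0 0 * moment 2 0 - moment 1 0 ^ 2 := by
  have h : ∀ u, HasDerivAt (fun u => 2 * moment 0 u * moment 2 u - moment 1 u ^ 2 +
      4 * u * moment 0 u ^ 2) 0 u := fun u => by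
    convert! (((((hasDerivAt_moment 0 u).const_mul 2).mul (hasDerivAt_moment 2 u)).sub
      ((hasDerivAt_moment 1 u).pow 2)).add
      (((hasDerivAt_id u).const_mul 4).mul ((hasDerivAt_moment 0 u).pow 2))) using 1
    simp only [id, Nat.cast_ofNat, Nat.add_one_sub_one, pow_one, zero_add, Nat.reduceAdd, mul_one,
      Pi.pow_apply]
    linear_combination (-2 * moment 0 u) * moment_recurrence u
  have := is_const_of_deriv_eq_zero (fun z => (h z).differentiableAt) (fun z => (h z).deriv) u 0
  simpa using this

theorem moment_ofReal (j : ℕ) (x : ℝ) : moment j x =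
    ((∫ s : ℝ, s ^ (2 * j) * Real.exp (-x * s ^ 2 - s ^ 6 / 12) : ℝ) : ℂ) := by
  rw [moment, ← integral_complex_ofReal]
  congr 1
  funext s
  push_cast
  rfl

/-- The values of the moments at `0`. -/
noncomputable def momentZero (j : ℕ) : ℝ := 12 ^ ((2 * j + 1) / 6 : ℝ) * Real.Gamma ((2 * j + 1) / 6) / 3

theorem moment_zero (j : ℕ) : moment j 0 = (momentZero j : ℂ) := by
  have h := moment_ofReal j 0
  rw [Complex.ofReal_zero] at h
  rw [h]
  congr 1
  have e : ∀ s : ℝ, s ^ (2 * j) * Real.exp (-0 * s ^ 2 - s ^ 6 / 12) =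
      (fun t : ℝ => t ^ (2 * j) * Real.exp (-(1 / 12) * t ^ 6)) |s| := fun s => by
    simp only [pow_mul, sq_abs]
    rw [show |s| ^ 6 = (|s| ^ 2) ^ 3 by ring, sq_abs]
    congr 2; ring
  rw [integral_congr_ae (Eventually.of_forall e),
    integral_comp_abs (f := fun t : ℝ => t ^ (2 * j) * Real.exp (-(1 / 12) * t ^ 6))]
  have e2 : ∫ t in Ioi (0 : ℝ), (fun t : ℝ => t ^ (2 * j) * Real.exp (-(1 / 12) * t ^ 6)) t =
      ∫ t in Ioi (0 : ℝ), t ^ ((2 * j : ℕ) : ℝ) * Real.exp (-(1 / 12) * t ^ (6 : ℝ)) := by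
    refine setIntegral_congr_fun measurableSet_Ioi fun t _ => ?_
    simp only [Real.rpow_natCast]
    norm_cast
  rw [e2, integral_rpow_mul_exp_neg_mul_rpow (by norm_num)
    (by have : (0 : ℝ) ≤ ((2 * j : ℕ) : ℝ) := Nat.cast_nonneg _
        linarith) (by norm_num), momentZero, one_div, Real.inv_rpow (by norm_num),
    neg_div, Real.rpow_neg (by norm_num), inv_inv]
  push_cast
  ring

theorem momentZero_pos (j : ℕ) : 0 < momentZero j := by
  have := Real.Gamma_pos_of_pos (show (0 : ℝ) < (2 * j + 1) / 6 by positivity)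
  unfold momentZero
  positivity

/-- Reflection formula: Γ(1/6) Γ(5/6) = π / sin(π/6) = 2π = 2 Γ(1/2)². It makes the conserved
quantity equal to 3 · `momentZero 1 ^ 2`, whence the value of `freq`. -/
theorem momentZero_mul : momentZero 0 * momentZero 2 = 2 * momentZero 1 ^ 2 := by
  have h1 := Real.Gamma_mul_Gamma_one_sub (1 / 6)
  rw [show Real.pi * (1 / 6) = Real.pi / 6 by ring, Real.sin_pi_div_six] at h1
  have h2 : (12 : ℝ) ^ (1 / 6 : ℝ) * (12 : ℝ) ^ (5 / 6 : ℝ) = 12 := by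
    rw [← Real.rpow_add (by norm_num)]; norm_num
  have h3 : ((12 : ℝ) ^ (1 / 2 : ℝ)) ^ 2 = 12 := by
    rw [← Real.rpow_natCast, ← Real.rpow_mul (by norm_num)]; norm_num
  have h4 : Real.Gamma (1 / 2) ^ 2 = Real.pi := by
    rw [Real.Gamma_one_half_eq, Real.sq_sqrt Real.pi_pos.le]
  simp only [momentZero]
  norm_num at h1 h2 h3 h4 ⊢
  calc _ = ((12 : ℝ) ^ (1 / 6 : ℝ) * (12 : ℝ) ^ (5 / 6 : ℝ)) *
        (Real.Gamma (1 / 6) * Real.Gamma (5 / 6)) / 9 := by ring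
    _ = 2 * (((12 : ℝ) ^ (1 / 2 : ℝ)) ^ 2 * Real.Gamma (1 / 2) ^ 2) / 9 := by
      rw [h2, h1, h3, h4]; ring
    _ = _ := by ring

/-- Legendre duplication at 1/6, relating Γ(1/6), Γ(2/3) and Γ(1/3). It links the logarithmic
derivative of Ai at 0 to that of q, and decides which phase factors vanish. -/
theorem ai0'_mul_momentZero : ai0' * momentZero 0 = -(ai0 * momentZero 1) := by
  have g1 := Real.Gamma_pos_of_pos (show (0 : ℝ) < 1 / 3 by norm_num)
  have g2 := Real.Gamma_pos_of_pos (show (0 : ℝ) < 2 / 3 by norm_num)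
  have h1 := Real.Gamma_mul_Gamma_add_half (1 / 6)
  have h2 : (12 : ℝ) ^ (1 / 6 : ℝ) = 2 ^ (1 / 3 : ℝ) * 3 ^ (1 / 6 : ℝ) := by
    rw [show (12 : ℝ) = 2 ^ (2 : ℝ) * 3 by norm_num, Real.mul_rpow (by norm_num) (by norm_num),
      ← Real.rpow_mul (by norm_num)]
    norm_num
  have h3 : (12 : ℝ) ^ (1 / 2 : ℝ) = 2 * 3 ^ (1 / 2 : ℝ) := by
    rw [show (12 : ℝ) = 2 ^ (2 : ℝ) * 3 by norm_num, Real.mul_rpow (by norm_num) (by norm_num),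
      ← Real.rpow_mul (by norm_num)]
    norm_num
  have h4 : (3 : ℝ) ^ (2 / 3 : ℝ) * 3 ^ (1 / 6 : ℝ) = 3 ^ (1 / 3 : ℝ) * 3 ^ (1 / 2 : ℝ) := by
    rw [← Real.rpow_add (by norm_num), ← Real.rpow_add (by norm_num)]; norm_num
  have h5 : (2 : ℝ) ^ (1 / 3 : ℝ) * 2 ^ (2 / 3 : ℝ) = 2 := by
    rw [← Real.rpow_add (by norm_num)]; norm_num
  simp only [momentZero, ai0, ai0']
  norm_num at h1 h2 h3 h4 h5 ⊢
  rw [Real.Gamma_one_half_eq, h2, h3]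
  have t1 : (0 : ℝ) < 3 ^ (1 / 3 : ℝ) := by positivity
  have t2 : (0 : ℝ) < 3 ^ (2 / 3 : ℝ) := by positivity
  field_simp
  calc _ = ((3 : ℝ) ^ (2 / 3 : ℝ) * 3 ^ (1 / 6 : ℝ)) * 2 ^ (1 / 3 : ℝ) *
        (Real.Gamma (1 / 6) * Real.Gamma (2 / 3)) := by ring
    _ = ((3 : ℝ) ^ (1 / 3 : ℝ) * 3 ^ (1 / 2 : ℝ)) * (2 ^ (1 / 3 : ℝ) * 2 ^ (2 / 3 : ℝ)) *
        Real.Gamma (1 / 3) * √Real.pi := by rw [h4, h1]; ring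
    _ = _ := by rw [h5]; ring

/-! ### Estimates in a sector around the positive axis -/

theorem norm_moment_zero_le {u : ℂ} (hu : 0 < u.re) : ‖moment 0 u‖ ≤ √(Real.pi / u.re) := by
  rw [← integral_gaussian u.re]
  refine norm_integral_le_of_norm_le (integrable_exp_neg_mul_sq hu)
    (Eventually.of_forall fun s => ?_)
  rw [norm_moment_integrand, mul_zero, pow_zero, one_mul]
  gcongr
  have : 0 ≤ s ^ 6 := by positivity
  linarith

theorem norm_moment_one_le {u : ℂ} (hu : 0 < u.re) :
    ‖moment 1 u‖ ≤ 2 / u.re * √(Real.pi / (u.re / 2)) := by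
  have hu2 : 0 < u.re / 2 := by positivity
  rw [← integral_gaussian (u.re / 2), ← integral_const_mul]
  refine norm_integral_le_of_norm_le ((integrable_exp_neg_mul_sq hu2).const_mul _)
    (Eventually.of_forall fun s => ?_)
  rw [norm_moment_integrand, mul_one]
  -- The factor s² is absorbed at the price of half of the Gaussian exponent.
  have h1 : s ^ 2 ≤ 2 / u.re * Real.exp (u.re / 2 * s ^ 2) := by
    have := Real.add_one_le_exp (u.re / 2 * s ^ 2)
    calc s ^ 2 = 2 / u.re * (u.re / 2 * s ^ 2) := by field_simp
      _ ≤ _ := by gcongr; linarith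
  calc s ^ 2 * Real.exp (-u.re * s ^ 2 - s ^ 6 / 12)
      ≤ (2 / u.re * Real.exp (u.re / 2 * s ^ 2)) * Real.exp (-u.re * s ^ 2) := by
        gcongr
        have : 0 ≤ s ^ 6 := by positivity
        linarith
    _ = _ := by rw [mul_assoc, ← Real.exp_add]; congr 2; ring

/-- Here |exp(-s⁶/12) - 1| ≤ s⁶/12, and s⁶/12 = (4/x³) · (x s²/2)³/3! with x = Re u is absorbed by
half of the Gaussian. -/
theorem norm_moment_zero_sub_le {u : ℂ} (hu : 0 < u.re) :
    ‖moment 0 u - (Real.pi / u) ^ (1 / 2 : ℂ)‖ ≤ 4 / u.re ^ 3 * √(Real.pi / (u.re / 2)) := by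
  have hu2 : 0 < u.re / 2 := by positivity
  have i0 := integrable_moment 0 u
  have i1 := integrable_cexp_neg_mul_sq hu
  rw [← integral_gaussian_complex hu, moment, ← integral_sub i0 i1, ← integral_gaussian (u.re / 2),
    ← integral_const_mul]
  refine norm_integral_le_of_norm_le ((integrable_exp_neg_mul_sq hu2).const_mul _)
    (Eventually.of_forall fun s => ?_)
  set y := s ^ 6 / 12 with hy
  have hy0 : 0 ≤ y := by positivity
  have e1 : (s : ℂ) ^ (2 * 0) * Complex.exp (-u * s ^ 2 - s ^ 6 / 12) -
      Complex.exp (-u * s ^ 2) = ((Real.exp (-y) - 1 : ℝ) : ℂ) * Complex.exp (-u * s ^ 2) := by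
    rw [sub_eq_add_neg (-u * (s : ℂ) ^ 2), Complex.exp_add, hy]
    push_cast
    ring_nf
  have e2 : ‖Complex.exp (-u * s ^ 2)‖ = Real.exp (-u.re * s ^ 2) := by
    rw [Complex.norm_exp, ← Complex.ofReal_pow, Complex.re_mul_ofReal, Complex.neg_re]
  have e3 : |Real.exp (-y) - 1| ≤ y := by
    rw [abs_le]
    have := Real.add_one_le_exp (-y)
    have := Real.exp_le_one_iff.2 (neg_nonpos.2 hy0)
    constructor <;> linarith
  rw [e1, norm_mul, Complex.norm_real, Real.norm_eq_abs, e2]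
  have h1 : y ≤ 4 / u.re ^ 3 * Real.exp (u.re / 2 * s ^ 2) := by
    have := Real.pow_div_factorial_le_exp (u.re / 2 * s ^ 2) (by positivity) 3
    calc y = 4 / u.re ^ 3 * ((u.re / 2 * s ^ 2) ^ 3 / Nat.factorial 3) := by
          rw [hy]; simp only [Nat.factorial]; push_cast; field_simp; ring
      _ ≤ _ := by gcongr
  calc |Real.exp (-y) - 1| * Real.exp (-u.re * s ^ 2)
      ≤ (4 / u.re ^ 3 * Real.exp (u.re / 2 * s ^ 2)) * Real.exp (-u.re * s ^ 2) := by
        gcongr; exact e3.trans h1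
    _ = _ := by rw [mul_assoc, ← Real.exp_add]; congr 2; ring

theorem moment_zero_ofReal_pos (x : ℝ) : 0 < (moment 0 x).re ∧ (moment 0 x).im = 0 := by
  rw [moment_ofReal]
  refine ⟨?_, Complex.ofReal_im _⟩
  rw [Complex.ofReal_re]
  simp only [mul_zero, pow_zero, one_mul]
  refine integral_exp_pos ?_
  refine (integrable_moment_bound 0 (abs_nonneg x)).mono' (by fun_prop)
    (Eventually.of_forall fun s => ?_)
  rw [Real.norm_of_nonneg (Real.exp_pos _).le, mul_zero, pow_zero, one_mul]
  gcongr
  exact neg_le_abs x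

/-- The hypothesis means |arg v| ≤ π/3 for v ≠ 0, so the principal square root has argument at most
π/6 in modulus, and cos²(π/6) = 3/4. -/
theorem re_cpow_half_ge {v : ℂ} (hv : ‖v‖ ≤ 2 * v.re) :
    3 / 4 * ‖v‖ ≤ ((v ^ (1 / 2 : ℂ)).re) ^ 2 ∧ 0 ≤ (v ^ (1 / 2 : ℂ)).re := by
  set r := v ^ (1 / 2 : ℂ) with hr
  have hsq : r ^ 2 = v := by
    rw [hr, one_div]; exact Complex.cpow_nat_inv_pow v two_ne_zero
  have h1 : ‖v‖ = r.re ^ 2 + r.im ^ 2 := by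
    rw [← hsq, norm_pow, Complex.sq_norm, Complex.normSq_apply]; ring
  have h2 : v.re = r.re ^ 2 - r.im ^ 2 := by
    rw [← hsq, pow_two, Complex.mul_re]; ring
  refine ⟨by nlinarith, ?_⟩
  rcases eq_or_ne v 0 with h0 | h0
  · rw [hr, h0]; simp
  · rw [hr, Complex.cpow_def_of_ne_zero h0, Complex.exp_re]
    refine mul_nonneg (Real.exp_pos _).le (Real.cos_nonneg_of_mem_Icc ?_)
    have e : (Complex.log v * (1 / 2)).im = v.arg / 2 := by
      rw [show (1 / 2 : ℂ) = ((1 / 2 : ℝ) : ℂ) by push_cast; rfl, Complex.im_mul_ofReal,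
        Complex.log_im]
      ring
    rw [e]
    constructor <;> linarith [Complex.neg_pi_lt_arg v, Complex.arg_le_pi v]

/-- The main term (π/u)^{1/2} has real part at least √(3/8) t ≥ (3/5) t, where t = √(π / Re u), and
for Re u ≥ 4 the error is at most t/10. -/
theorem le_re_moment_zero {u : ℂ} (hu : 4 ≤ u.re) (hu2 : ‖u‖ ≤ 2 * u.re) :
    1 / 2 * √(Real.pi / u.re) ≤ (moment 0 u).re := by
  set x := u.re with hx
  have hx0 : 0 < x := by linarith
  have hu0 : 0 < ‖u‖ := by
    rw [norm_pos_iff]; rintro rfl; simp [hx] at hx0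
  have hπ := Real.pi_pos
  have hre : ((Real.pi : ℂ) / u).re = Real.pi * x / ‖u‖ ^ 2 := by
    rw [Complex.div_re, Complex.ofReal_re, Complex.ofReal_im, Complex.sq_norm]; ring
  have hnorm : ‖(Real.pi : ℂ) / u‖ = Real.pi / ‖u‖ := by
    rw [norm_div, Complex.norm_real, Real.norm_of_nonneg hπ.le]
  obtain ⟨h1, h2⟩ := re_cpow_half_ge (v := (Real.pi : ℂ) / u) (by
    rw [hre, hnorm, div_le_iff₀ hu0, show 2 * (Real.pi * x / ‖u‖ ^ 2) * ‖u‖ =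
      Real.pi * (2 * x) / ‖u‖ by field_simp, le_div_iff₀ hu0]
    gcongr)
  set ρ := (((Real.pi : ℂ) / u) ^ (1 / 2 : ℂ)).re with hρ
  set t := √(Real.pi / x) with ht
  have ht0 : 0 < t := by positivity
  have ht2 : t ^ 2 = Real.pi / x := Real.sq_sqrt (by positivity)
  have h3 : 3 / 8 * t ^ 2 ≤ ρ ^ 2 := by
    refine le_trans ?_ h1
    rw [hnorm, ht2, show (3 / 8 : ℝ) * (Real.pi / x) = 3 / 4 * (Real.pi / (2 * x)) by
      field_simp; norm_num]
    gcongr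
  have h4 : 3 / 5 * t ≤ ρ := by
    refine le_of_sq_le_sq ?_ h2
    nlinarith
  have h5 := norm_moment_zero_sub_le (u := u) hx0
  have h6 : 4 / x ^ 3 * √(Real.pi / (x / 2)) ≤ 1 / 10 * t := by
    have e1 : √(Real.pi / (x / 2)) ≤ 3 / 2 * t := by
      rw [Real.sqrt_le_left (by positivity), mul_pow, ht2]
      have : Real.pi / (x / 2) = 2 * (Real.pi / x) := by field_simp
      rw [this]
      have : 0 < Real.pi / x := by positivity
      linarith
    have e2 : 4 / x ^ 3 ≤ 1 / 16 := by
      rw [div_le_div_iff₀ (by positivity) (by norm_num)]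
      have : (4 : ℝ) ^ 3 ≤ x ^ 3 := by gcongr
      linarith
    calc _ ≤ 1 / 16 * (3 / 2 * t) := by gcongr
      _ ≤ _ := by linarith
  have h7 := (Complex.abs_re_le_norm _).trans (h5.trans h6)
  rw [Complex.sub_re, abs_le] at h7
  linarith [h7.1]

theorem moment_zero_ne_zero {u : ℂ} (hu : 4 ≤ u.re) (hu2 : ‖u‖ ≤ 2 * u.re) : moment 0 u ≠ 0 := by
  intro h
  have := le_re_moment_zero hu hu2
  rw [h, Complex.zero_re] at this
  have : 0 < √(Real.pi / u.re) := by
    have := Real.pi_pos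
    have : 0 < u.re := by linarith
    positivity
  linarith

theorem le_re_inv_moment_zero {u : ℂ} (hu : 4 ≤ u.re) (hu2 : ‖u‖ ≤ 2 * u.re) :
    1 / 2 * √(u.re / Real.pi) ≤ ((moment 0 u)⁻¹).re := by
  have h1 := le_re_moment_zero hu hu2
  have hx0 : 0 < u.re := by linarith
  have hπ := Real.pi_pos
  have h2 := norm_moment_zero_le hx0
  have hne := norm_pos_iff.2 (moment_zero_ne_zero hu hu2)
  set t := √(Real.pi / u.re) with ht
  have ht0 : 0 < t := by positivity
  have e : √(u.re / Real.pi) = 1 / t := by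
    rw [ht, ← inv_div, Real.sqrt_inv, one_div]
  rw [Complex.inv_re, e, ← Complex.sq_norm]
  calc 1 / 2 * (1 / t) = (1 / 2 * t) / t ^ 2 := by field_simp
    _ ≤ (moment 0 u).re / ‖moment 0 u‖ ^ 2 := by gcongr; linarith

/-! ### Phase factors -/

/-- The unit vector in the direction `π / 3`. -/
noncomputable def dir : ℂ := Complex.exp ((Real.pi / 3 : ℝ) * Complex.I)

theorem dir_re : dir.re = 1 / 2 := by
  rw [dir, Complex.exp_ofReal_mul_I_re, Real.cos_pi_div_three]

theorem dir_im : dir.im = √3 / 2 := by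
  rw [dir, Complex.exp_ofReal_mul_I_im, Real.sin_pi_div_three]

theorem dir_cube : dir ^ 3 = -1 := by
  rw [dir, ← Complex.exp_nat_mul, ← Complex.exp_pi_mul_I]
  congr 1
  push_cast
  ring

theorem norm_dir : ‖dir‖ = 1 := Complex.norm_exp_ofReal_mul_I _

theorem dir_mul_conj : dir * starRingEnd ℂ dir = 1 := by
  rw [Complex.mul_conj', norm_dir]; norm_num

theorem dir_ne_zero : dir ≠ 0 := Complex.exp_ne_zero _

/-- The asymptotic frequency `κ` in `q g' - (q' / 2) g ± i κ g`, where `q = moment 0`. -/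
noncomputable def freq : ℝ := √3 / 2 * momentZero 1

theorem freq_pos : 0 < freq := mul_pos (by positivity) (momentZero_pos 1)

theorem moment_zero_ofReal_ne_zero (x : ℝ) : moment 0 x ≠ 0 := fun h => by
  have := (moment_zero_ofReal_pos x).1
  rw [h] at this
  simp at this

theorem I_freq_sq : (Complex.I * (freq : ℂ)) ^ 2 = -(freq : ℂ) ^ 2 := by
  rw [mul_pow, Complex.I_sq]; ring

theorem moment_invariant_eq (u : ℂ) :
    2 * moment 0 u * moment 2 u - moment 1 u ^ 2 + 4 * u * moment 0 u ^ 2 = 4 * freq ^ 2 := by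
  rw [moment_invariant, moment_zero, moment_zero, moment_zero]
  have h3 : √(3 : ℝ) ^ 2 = 3 := Real.sq_sqrt (by norm_num)
  have h : 2 * momentZero 0 * momentZero 2 - momentZero 1 ^ 2 = 4 * freq ^ 2 := by
    rw [freq]
    linear_combination 2 * momentZero_mul - momentZero 1 ^ 2 * h3
  exact_mod_cast h

/-- For a solution `w` of the Airy equation let `g u = w (dir * u)`, so that `g'' = - u g`. With
`q = moment 0` this is `q g' - (q' / 2) g + τ g`, which for `τ = ± i κ` satisfies a first order
equation. -/
noncomputable def phaseFactor (w w' : ℂ → ℂ) (τ u : ℂ) : ℂ :=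
  moment 0 u * (dir * w' (dir * u)) + (moment 1 u / 2 + τ) * w (dir * u)

namespace IsAirySolution

variable {v v' w w' : ℂ → ℂ} {τ : ℂ}

theorem hasDerivAt_comp_dir (hw : IsAirySolution w w') (u : ℂ) :
    HasDerivAt (fun u => w (dir * u)) (dir * w' (dir * u)) u := by
  convert! (hw.hasDerivAt (dir * u)).comp u ((hasDerivAt_id u).const_mul dir) using 1
  ring

theorem hasDerivAt_comp_dir' (hw : IsAirySolution w w') (u : ℂ) :
    HasDerivAt (fun u => dir * w' (dir * u)) (-u * w (dir * u)) u := by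
  convert! ((hw.hasDerivAt_deriv (dir * u)).comp u ((hasDerivAt_id u).const_mul dir)).const_mul dir
    using 1
  linear_combination (-u * w (dir * u)) * dir_cube

/-- The condition on τ together with the first integral of q makes the second order operator factor:
the g' and g terms become proportional to the phase factor itself. -/
theorem hasDerivAt_phaseFactor (hw : IsAirySolution w w') (hτ : τ ^ 2 = -(freq : ℂ) ^ 2) (u : ℂ)
    (hu : moment 0 u ≠ 0) : HasDerivAt (phaseFactor w w' τ)
      ((τ - moment 1 u / 2) / moment 0 u * phaseFactor w w' τ u) u := by
  have h := ((hasDerivAt_moment 0 u).mul (hw.hasDerivAt_comp_dir' u)).add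
    ((((hasDerivAt_moment 1 u).div_const 2).add_const τ).mul (hw.hasDerivAt_comp_dir u))
  convert! h using 1
  rw [div_mul_eq_mul_div, div_eq_iff hu, phaseFactor]
  simp only [zero_add, Nat.reduceAdd]
  linear_combination w (dir * u) * (1 / 4 * moment_invariant_eq u + hτ)

theorem exists_phaseFactor_mul (hv : IsAirySolution v v') (hw : IsAirySolution w w')
    (hτ : τ ^ 2 = -(freq : ℂ) ^ 2) :
    ∃ C : ℂ, ∀ u, phaseFactor v v' τ u * phaseFactor w w' (-τ) u = C * moment 0 u := by
  -- H is a bilinear first integral of g'' = -u g built from q, q' and q'', plus τ times the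
  -- Wronskian; the product of the two phase factors equals q H.
  set H : ℂ → ℂ := fun u =>
    moment 0 u * ((dir * v' (dir * u)) * (dir * w' (dir * u))) +
    moment 1 u / 2 * (v (dir * u) * (dir * w' (dir * u)) + (dir * v' (dir * u)) * w (dir * u)) +
    (u * moment 0 u + moment 2 u / 2) * (v (dir * u) * w (dir * u)) +
    τ * (v (dir * u) * (dir * w' (dir * u)) - (dir * v' (dir * u)) * w (dir * u)) with hH
  have hd : ∀ u, HasDerivAt H 0 u := fun u => by
    have a1 := hv.hasDerivAt_comp_dir u
    have a2 := hv.hasDerivAt_comp_dir' u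
    have b1 := hw.hasDerivAt_comp_dir u
    have b2 := hw.hasDerivAt_comp_dir' u
    have m0 := hasDerivAt_moment 0 u
    have m1 := hasDerivAt_moment 1 u
    have m2 := hasDerivAt_moment 2 u
    convert! (((m0.mul (a2.mul b2)).add ((m1.div_const 2).mul ((a1.mul b2).add (a2.mul b1)))).add
      ((((hasDerivAt_id u).mul m0).add (m2.div_const 2)).mul (a1.mul b1))).add
      (((a1.mul b2).sub (a2.mul b1)).const_mul τ) using 1
    simp only [zero_add, Nat.reduceAdd, id, Pi.mul_apply, Pi.add_apply]
    linear_combination (-(1 / 2) * v (dir * u) * w (dir * u)) * moment_recurrence u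
  refine ⟨H 0, fun u => ?_⟩
  rw [← is_const_of_deriv_eq_zero (fun z => (hd z).differentiableAt) (fun z => (hd z).deriv) u 0]
  simp only [hH, phaseFactor]
  linear_combination (-v (dir * u) * w (dir * u)) * (1 / 4 * moment_invariant_eq u + hτ)

end IsAirySolution

/-! ### The ratio of the phase factors -/

theorem norm_le_exp_mul_of_hasDerivAt {φ p : ℝ → ℂ} {m L : ℝ} (hL : 0 ≤ L)
    (hφ : ∀ t ∈ Icc 0 L, HasDerivAt φ (-(p t) * φ t) t) (hp : ∀ t ∈ Icc 0 L, m ≤ (p t).re) :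
    ‖φ L‖ ≤ Real.exp (-(m * L)) * ‖φ 0‖ := by
  -- Energy form of Grönwall's inequality: exp(2 m t)|φ|² is nonincreasing.
  set ψ : ℝ → ℝ := fun t => Real.exp (2 * m * t) * ‖φ t‖ ^ 2 with hψ
  have hd : ∀ t ∈ Icc 0 L, HasDerivAt ψ
      (2 * Real.exp (2 * m * t) * (m - (p t).re) * ‖φ t‖ ^ 2) t := by
    intro t ht
    have h1 : HasDerivAt (fun t : ℝ => Real.exp (2 * m * t)) (Real.exp (2 * m * t) * (2 * m)) t := by
      simpa using ((hasDerivAt_id t).const_mul (2 * m)).exp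
    convert! h1.mul (hφ t ht).norm_sq using 1
    rw [Complex.inner, show -p t * φ t * starRingEnd ℂ (φ t) =
      -p t * (starRingEnd ℂ (φ t) * φ t) by ring, Complex.conj_mul', ← Complex.ofReal_pow,
      Complex.re_mul_ofReal, Complex.neg_re]
    ring
  have hanti : AntitoneOn ψ (Icc 0 L) := by
    refine antitoneOn_of_deriv_nonpos (convex_Icc 0 L)
      (fun t ht => (hd t ht).continuousAt.continuousWithinAt)
      (fun t ht => (hd t (interior_subset ht)).differentiableAt.differentiableWithinAt)
      fun t ht => ?_
    have ht' := interior_subset ht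
    rw [(hd t ht').deriv]
    have := hp t ht'
    exact mul_nonpos_of_nonpos_of_nonneg
      (mul_nonpos_of_nonneg_of_nonpos (by positivity) (by linarith)) (by positivity)
  have key := hanti ⟨le_rfl, hL⟩ ⟨hL, le_rfl⟩ hL
  simp only [hψ, mul_zero, Real.exp_zero, one_mul] at key
  have h : Real.exp (m * L) * ‖φ L‖ ≤ ‖φ 0‖ := by
    refine le_of_sq_le_sq ?_ (norm_nonneg _)
    calc _ = Real.exp (2 * m * L) * ‖φ L‖ ^ 2 := by
          rw [mul_pow, ← Real.exp_nat_mul]; congr 2; push_cast; ring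
      _ ≤ _ := key
  calc ‖φ L‖ = Real.exp (-(m * L)) * (Real.exp (m * L) * ‖φ L‖) := by
        rw [← mul_assoc, ← Real.exp_add, neg_add_cancel, Real.exp_zero, one_mul]
    _ ≤ _ := by gcongr

/-- The quotient of the two phase factors, which is the analogue of
`exp (2 i θ)` for the phase `θ` of the solution. -/
noncomputable def phaseRatio (w w' : ℂ → ℂ) (τ u : ℂ) : ℂ :=
  phaseFactor w w' τ u / phaseFactor w w' (-τ) u

theorem phaseRatio_neg (w w' : ℂ → ℂ) (τ u : ℂ) :
    phaseRatio w w' (-τ) u = (phaseRatio w w' τ u)⁻¹ := by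
  rw [phaseRatio, phaseRatio, neg_neg, inv_div]

/-- A solution with nonzero phase factors: it is not recessive in any of the two sectors adjacent
to the ray in the direction `dir`. -/
structure IsNonrecessive (w w' : ℂ → ℂ) : Prop extends IsAirySolution w w' where
  phaseFactor_zero_ne_zero (τ : ℂ) (hτ : τ ^ 2 = -(freq : ℂ) ^ 2) : phaseFactor w w' τ 0 ≠ 0

namespace IsNonrecessive

variable {w w' : ℂ → ℂ} {τ : ℂ}

theorem exists_const (hw : IsNonrecessive w w') (hτ : τ ^ 2 = -(freq : ℂ) ^ 2) :
    ∃ C : ℂ, C ≠ 0 ∧ ∀ u, phaseFactor w w' τ u * phaseFactor w w' (-τ) u = C * moment 0 u := by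
  obtain ⟨C, hC⟩ := hw.toIsAirySolution.exists_phaseFactor_mul hw.toIsAirySolution hτ
  refine ⟨C, ?_, hC⟩
  rintro rfl
  have := hC 0
  rw [zero_mul] at this
  exact mul_ne_zero (hw.phaseFactor_zero_ne_zero τ hτ)
    (hw.phaseFactor_zero_ne_zero (-τ) (by rw [neg_sq, hτ])) this

theorem phaseFactor_ne_zero (hw : IsNonrecessive w w') (hτ : τ ^ 2 = -(freq : ℂ) ^ 2) {u : ℂ}
    (hu : moment 0 u ≠ 0) : phaseFactor w w' τ u ≠ 0 := by
  obtain ⟨C, hC, h⟩ := hw.exists_const hτ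
  have := h u
  intro h0
  rw [h0, zero_mul] at this
  exact mul_ne_zero hC hu this.symm

theorem hasDerivAt_phaseRatio (hw : IsNonrecessive w w') (hτ : τ ^ 2 = -(freq : ℂ) ^ 2) {u : ℂ}
    (hu : moment 0 u ≠ 0) : HasDerivAt (phaseRatio w w' τ)
      (2 * τ / moment 0 u * phaseRatio w w' τ u) u := by
  have hτ' : (-τ) ^ 2 = -(freq : ℂ) ^ 2 := by rw [neg_sq, hτ]
  have hne := hw.phaseFactor_ne_zero hτ' hu
  convert! (hw.hasDerivAt_phaseFactor hτ u hu).div (hw.hasDerivAt_phaseFactor hτ' u hu) hne using 1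
  rw [phaseRatio]
  field_simp
  ring

theorem phaseRatio_ne_zero (hw : IsNonrecessive w w') (hτ : τ ^ 2 = -(freq : ℂ) ^ 2) {u : ℂ}
    (hu : moment 0 u ≠ 0) : phaseRatio w w' τ u ≠ 0 :=
  div_ne_zero (hw.phaseFactor_ne_zero hτ hu)
    (hw.phaseFactor_ne_zero (by rw [neg_sq, hτ]) hu)

theorem norm_phaseRatio_line_le (hw : IsNonrecessive w w') (hτ : τ ^ 2 = -(freq : ℂ) ^ 2)
    {z d : ℂ} {m L : ℝ} (hL : 0 ≤ L) (hne : ∀ t ∈ Icc 0 L, moment 0 (z + (t : ℝ) * d) ≠ 0)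
    (hm : ∀ t ∈ Icc 0 L, m ≤ (-(2 * τ / moment 0 (z + (t : ℝ) * d) * d)).re) :
    ‖phaseRatio w w' τ (z + L * d)‖ ≤ Real.exp (-(m * L)) * ‖phaseRatio w w' τ z‖ := by
  have := norm_le_exp_mul_of_hasDerivAt (φ := fun t : ℝ => phaseRatio w w' τ (z + t * d))
    (p := fun t => -(2 * τ / moment 0 (z + (t : ℝ) * d) * d)) hL (fun t ht => by
      convert! hasDerivAt_comp_line (s := t) (hw.hasDerivAt_phaseRatio hτ (hne t ht)) using 1
      ring) hm
  simpa using this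

/-- On the real axis q is real and the coefficient 2τ/q purely imaginary, so the modulus does not
grow. Using both signs of τ, which invert the ratio, gives constancy. -/
theorem norm_phaseRatio_ofReal_le (hw : IsNonrecessive w w') {σ : ℝ}
    (hσ : ((σ : ℂ) * (Complex.I * freq)) ^ 2 = -(freq : ℂ) ^ 2) {x : ℝ} (hx : 0 ≤ x) :
    ‖phaseRatio w w' (σ * (Complex.I * freq)) x‖ ≤ ‖phaseRatio w w' (σ * (Complex.I * freq)) 0‖ := by
  have e : ∀ t : ℝ, (0 : ℂ) + (t : ℂ) * 1 = t := fun t => by ring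
  have := hw.norm_phaseRatio_line_le hσ (z := 0) (d := 1) (m := 0) hx
    (fun t _ => by rw [e]; exact moment_zero_ofReal_ne_zero t) (fun t _ => by
      rw [e, mul_one]
      have h : moment 0 t = ((moment 0 t).re : ℂ) :=
        Complex.ext rfl (by rw [(moment_zero_ofReal_pos t).2, Complex.ofReal_im])
      rw [h, show -(2 * ((σ : ℂ) * (Complex.I * freq)) / ((moment 0 t).re : ℂ)) =
        ((-(2 * σ * freq / (moment 0 t).re) : ℝ) : ℂ) * Complex.I by push_cast; ring,
        Complex.re_ofReal_mul, Complex.I_re, mul_zero])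
  rw [e] at this
  simpa using this

theorem norm_phaseRatio_ofReal (hw : IsNonrecessive w w') {x : ℝ} (hx : 0 ≤ x) :
    ‖phaseRatio w w' (Complex.I * freq) x‖ = ‖phaseRatio w w' (Complex.I * freq) 0‖ := by
  have h1 := hw.norm_phaseRatio_ofReal_le (σ := 1) (by simp [I_freq_sq]) hx
  have h2 := hw.norm_phaseRatio_ofReal_le (σ := -1) (by simp [I_freq_sq]) hx
  have h0 : moment 0 0 ≠ 0 := by simpa using moment_zero_ofReal_ne_zero 0
  simp only [Complex.ofReal_neg, Complex.ofReal_one, one_mul, neg_mul, phaseRatio_neg,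
    norm_inv] at h1 h2
  refine le_antisymm h1 ?_
  rwa [inv_le_inv₀ (norm_pos_iff.2 (hw.phaseRatio_ne_zero I_freq_sq
    (moment_zero_ofReal_ne_zero x))) (norm_pos_iff.2 (hw.phaseRatio_ne_zero I_freq_sq h0))] at h2

/-- Exponential decay of the phase ratio perpendicularly to the positive axis. -/
theorem norm_phaseRatio_vertical_le (hw : IsNonrecessive w w') {σ : ℝ} (hσ : σ ^ 2 = 1)
    {x y : ℝ} (hx : 4 ≤ x) (hy : 0 ≤ y) (hxy : ‖(x : ℂ) + y * (σ * Complex.I)‖ ≤ 2 * x) :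
    ‖phaseRatio w w' (σ * (Complex.I * freq)) (x + y * (σ * Complex.I))‖ ≤
      Real.exp (-(freq * √(x / Real.pi) * y)) *
        ‖phaseRatio w w' (σ * (Complex.I * freq)) 0‖ := by
  have hσ' : (σ : ℂ) ^ 2 = 1 := by exact_mod_cast hσ
  have hτ : ((σ : ℂ) * (Complex.I * freq)) ^ 2 = -(freq : ℂ) ^ 2 := by
    rw [mul_pow, hσ', one_mul, I_freq_sq]
  have hre : ∀ t : ℝ, ((x : ℂ) + t * (σ * Complex.I)).re = x := fun t => by simp
  have hno : ∀ t : ℝ, ‖(x : ℂ) + t * (σ * Complex.I)‖ ^ 2 = x ^ 2 + t ^ 2 := fun t => by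
    rw [Complex.sq_norm, Complex.normSq_apply]
    simp
    linear_combination t ^ 2 * hσ
  have hD : ∀ t ∈ Icc 0 y, ‖(x : ℂ) + t * (σ * Complex.I)‖ ≤ 2 * x := fun t ht => by
    refine le_trans (le_of_sq_le_sq ?_ (norm_nonneg _)) hxy
    rw [hno, hno]
    have := ht.1
    have := ht.2
    gcongr
  refine (hw.norm_phaseRatio_line_le hτ (z := x) (d := σ * Complex.I)
    (m := freq * √(x / Real.pi)) hy
    (fun t ht => moment_zero_ne_zero (by rwa [hre]) (by rw [hre]; exact hD t ht))
    (fun t ht => ?_)).trans ?_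
  · have h1 := le_re_inv_moment_zero (u := x + t * (σ * Complex.I)) (by rwa [hre])
      (by rw [hre]; exact hD t ht)
    rw [hre] at h1
    -- The signs in τ and in the direction multiply to σ² = 1, so the decay rate is 2κ Re(1/q), at
    -- least κ√(x/π) in the sector.
    have e : -(2 * ((σ : ℂ) * (Complex.I * freq)) / moment 0 (x + t * (σ * Complex.I)) *
        (σ * Complex.I)) = ((2 * freq : ℝ) : ℂ) * (moment 0 (x + t * (σ * Complex.I)))⁻¹ := by
      rw [div_eq_mul_inv]
      push_cast
      linear_combination (-2 * freq * (moment 0 (x + t * (σ * Complex.I)))⁻¹) *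
        (Complex.I ^ 2 * hσ' + Complex.I_sq)
    rw [e, Complex.re_ofReal_mul]
    have := freq_pos
    calc freq * √(x / Real.pi) = 2 * freq * (1 / 2 * √(x / Real.pi)) := by ring
      _ ≤ _ := by gcongr
  · gcongr
    exact hw.norm_phaseRatio_ofReal_le hτ (by linarith)

/-- At a zero of w the ratio is 1. At a zero of w' it is (q₁/2 + τ)/(q₁/2 - τ) with q₁ = `moment 1
u`, and |q₁/2| ≤ κ/2 bounds this below by (κ/2)/(3κ/2). -/
theorem one_third_le_norm_phaseRatio (hw : IsNonrecessive w w') (hτ : τ ^ 2 = -(freq : ℂ) ^ 2)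
    {u : ℂ} (hu : moment 0 u ≠ 0) (h1 : ‖moment 1 u‖ ≤ freq)
    (h : w (dir * u) = 0 ∨ w' (dir * u) = 0) : 1 / 3 ≤ ‖phaseRatio w w' τ u‖ := by
  have hτ' : (-τ) ^ 2 = -(freq : ℂ) ^ 2 := by rw [neg_sq, hτ]
  have hne := hw.phaseFactor_ne_zero hτ' hu
  have hnorm : ‖τ‖ = freq := by
    have : ‖τ‖ ^ 2 = freq ^ 2 := by
      rw [← norm_pow, hτ, norm_neg, norm_pow, Complex.norm_real, Real.norm_of_nonneg freq_pos.le]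
    exact (pow_left_inj₀ (norm_nonneg _) freq_pos.le two_ne_zero).1 this
  have hf := freq_pos
  rw [phaseRatio, norm_div, le_div_iff₀ (norm_pos_iff.2 hne)]
  rcases h with h | h
  · simp only [phaseFactor, h, mul_zero, add_zero]
    have := norm_nonneg (moment 0 u * (dir * w' (dir * u)))
    linarith
  · simp only [phaseFactor, h, mul_zero, zero_add, norm_mul]
    have hq : ‖moment 1 u / 2‖ ≤ freq / 2 := by rw [norm_div]; norm_num; linarith
    have a1 := norm_add_le (moment 1 u / 2) (-τ)
    have a2 := norm_sub_norm_le τ (-(moment 1 u / 2))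
    rw [norm_neg, hnorm] at a1
    rw [norm_neg, hnorm, sub_neg_eq_add, add_comm] at a2
    rw [← mul_assoc]
    gcongr
    linarith

end IsNonrecessive

/-! ### Zeros near the ray in the direction `dir` -/

theorem exists_norm_moment_one_le {ε : ℝ} (hε : 0 < ε) :
    ∃ X : ℝ, ∀ u : ℂ, X ≤ u.re → ‖moment 1 u‖ ≤ ε := by
  refine ⟨max (2 * Real.pi) (2 / ε), fun u hu => ?_⟩
  have h1 : 2 * Real.pi ≤ u.re := (le_max_left _ _).trans hu
  have h2 : 2 / ε ≤ u.re := (le_max_right _ _).trans hu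
  have hπ := Real.pi_pos
  have hx : 0 < u.re := by linarith
  refine (norm_moment_one_le hx).trans ?_
  have h3 : √(Real.pi / (u.re / 2)) ≤ 1 := by
    rw [Real.sqrt_le_one]
    rw [div_le_one (by positivity)]
    linarith
  rw [div_le_iff₀ hε] at h2
  calc 2 / u.re * √(Real.pi / (u.re / 2)) ≤ 2 / u.re * 1 := by gcongr
    _ ≤ ε := by rw [mul_one, div_le_iff₀ hx]; linarith

theorem tendsto_freq_mul_sqrt : Tendsto (fun x : ℝ => freq * √(x / Real.pi)) atTop atTop :=
  (Real.tendsto_sqrt_atTop.comp (tendsto_id.atTop_div_const Real.pi_pos)).const_mul_atTop freq_pos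

theorem conj_dir_mul_re (z : ℂ) : (starRingEnd ℂ dir * z).re = 1 / 2 * z.re + √3 / 2 * z.im := by
  simp [Complex.mul_re, dir_re, dir_im]

theorem dir_mul_im (u : ℂ) : (dir * u).im = 1 / 2 * u.im + √3 / 2 * u.re := by
  simp [Complex.mul_im, dir_re, dir_im]

theorem dir_mul_conj_dir_mul (z : ℂ) : dir * (starRingEnd ℂ dir * z) = z := by
  rw [← mul_assoc, dir_mul_conj, one_mul]

theorem norm_conj_dir_mul (z : ℂ) : ‖starRingEnd ℂ dir * z‖ = ‖z‖ := by
  rw [norm_mul, RCLike.norm_conj, norm_dir, one_mul]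

/-- Rotation by -π/3 takes the first quadrant to -π/3 ≤ arg ≤ π/6, inside the sector where the
estimates for q hold. -/
theorem norm_le_two_mul_re {z : ℂ} (h1 : 0 ≤ z.re) (h2 : 0 ≤ z.im) :
    ‖starRingEnd ℂ dir * z‖ ≤ 2 * (starRingEnd ℂ dir * z).re := by
  rw [norm_conj_dir_mul, conj_dir_mul_re]
  have h3 : 1 ≤ √(3 : ℝ) := Real.one_le_sqrt.2 (by norm_num)
  have := Complex.norm_le_abs_re_add_abs_im z
  rw [abs_of_nonneg h1, abs_of_nonneg h2] at this
  nlinarith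

namespace IsNonrecessive

variable {w w' : ℂ → ℂ}

/-- At height y ≥ ε the exponential decay pushes the ratio below 1/3 once x is large, contradicting
the lower bound at zeros. The two signs of σ treat the two sides of the axis. -/
theorem exists_abs_lt_of_zero (hw : IsNonrecessive w w') {σ : ℝ} (hσ : σ ^ 2 = 1) {ε : ℝ}
    (hε : 0 < ε) : ∃ X : ℝ, ∀ x y : ℝ, X ≤ x → ‖(x : ℂ) + y * (σ * Complex.I)‖ ≤ 2 * x →
      (w (dir * (x + y * (σ * Complex.I))) = 0 ∨ w' (dir * (x + y * (σ * Complex.I))) = 0) →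
      y < ε := by
  set K := ‖phaseRatio w w' (σ * (Complex.I * freq)) 0‖ with hK
  have ht : Tendsto (fun x : ℝ => Real.exp (-(freq * √(x / Real.pi) * ε)) * K) atTop (𝓝 0) := by
    have := (Real.tendsto_exp_neg_atTop_nhds_zero.comp
      (tendsto_freq_mul_sqrt.atTop_mul_const hε)).mul_const K
    rwa [zero_mul] at this
  obtain ⟨X1, h1⟩ := eventually_atTop.1 (ht.eventually_lt_const (show (0 : ℝ) < 1 / 3 by norm_num))
  obtain ⟨X2, h2⟩ := exists_norm_moment_one_le freq_pos
  refine ⟨max 4 (max X1 X2), fun x y hx hxy hz => ?_⟩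
  have hx4 : 4 ≤ x := (le_max_left _ _).trans hx
  have hx1 : X1 ≤ x := (le_max_left _ _).trans ((le_max_right _ _).trans hx)
  have hx2 : X2 ≤ x := (le_max_right _ _).trans ((le_max_right _ _).trans hx)
  have hre : ((x : ℂ) + y * (σ * Complex.I)).re = x := by simp
  have hτ : ((σ : ℂ) * (Complex.I * freq)) ^ 2 = -(freq : ℂ) ^ 2 := by
    rw [mul_pow, I_freq_sq]
    norm_cast
    rw [hσ]; simp
  by_contra! hy
  have a1 := hw.norm_phaseRatio_vertical_le hσ hx4 (hε.le.trans hy) hxy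
  have a2 := hw.one_third_le_norm_phaseRatio hτ
    (moment_zero_ne_zero (by rwa [hre]) (by rwa [hre])) (h2 _ (by rwa [hre])) hz
  have a3 := h1 x hx1
  have a4 : Real.exp (-(freq * √(x / Real.pi) * y)) * K ≤
      Real.exp (-(freq * √(x / Real.pi) * ε)) * K := by
    have := freq_pos
    gcongr
  linarith

/-- Zeros in the open first quadrant approach the ray in the direction `dir`. -/
theorem exists_norm_sub_lt_of_zero (hw : IsNonrecessive w w') {ε : ℝ} (hε : 0 < ε) :
    ∃ R : ℝ, ∀ z : ℂ, R < ‖z‖ → 0 < z.re → 0 < z.im → (w z = 0 ∨ w' z = 0) →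
      ∃ r : ℝ, 0 ≤ r ∧ ‖z - r * dir‖ < ε := by
  obtain ⟨X1, h1⟩ := hw.exists_abs_lt_of_zero (σ := 1) (by norm_num) hε
  obtain ⟨X2, h2⟩ := hw.exists_abs_lt_of_zero (σ := -1) (by norm_num) hε
  refine ⟨2 * max X1 X2, fun z hz hre him h0 => ?_⟩
  set u := starRingEnd ℂ dir * z with hu
  have hzu : dir * u = z := dir_mul_conj_dir_mul z
  have hn : ‖u‖ ≤ 2 * u.re := norm_le_two_mul_re hre.le him.le
  have hn2 : ‖u‖ = ‖z‖ := norm_conj_dir_mul z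
  have hx : max X1 X2 ≤ u.re := by linarith
  have e1 : ((u.re : ℝ) : ℂ) + (u.im : ℝ) * ((1 : ℝ) * Complex.I) = u := by
    rw [Complex.ofReal_one, one_mul, Complex.re_add_im]
  have e2 : ((u.re : ℝ) : ℂ) + (-u.im : ℝ) * ((-1 : ℝ) * Complex.I) = u := by
    apply Complex.ext <;> simp
  have a1 := h1 u.re u.im ((le_max_left _ _).trans hx) (by rwa [e1]) (by rwa [e1, hzu])
  have a2 := h2 u.re (-u.im) ((le_max_right _ _).trans hx) (by rwa [e2]) (by rwa [e2, hzu])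
  refine ⟨u.re, by linarith [norm_nonneg u], ?_⟩
  have e3 : z - u.re * dir = dir * ((u.im : ℂ) * Complex.I) := by
    rw [← hzu]
    nth_rewrite 1 [← Complex.re_add_im u]
    ring
  rw [e3, norm_mul, norm_dir, norm_mul, Complex.norm_I, Complex.norm_real, Real.norm_eq_abs,
    one_mul, mul_one, abs_lt]
  constructor <;> linarith

theorem mem_sector_of_dist_lt {x : ℝ} (hx : 6 ≤ x) {u : ℂ} (hu : ‖u - x‖ < 2) :
    4 ≤ u.re ∧ ‖u‖ ≤ 2 * u.re := by
  have h1 := (Complex.abs_re_le_norm (u - x)).trans_lt hu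
  rw [Complex.sub_re, Complex.ofReal_re, abs_lt] at h1
  have h2 := norm_le_norm_add_norm_sub' u x
  rw [Complex.norm_real, Real.norm_of_nonneg (by linarith)] at h2
  constructor <;> linarith [h1.1]

/-- The logarithm of the phase ratio is locally surjective at a uniform scale, far out near the
positive axis. -/
theorem exists_phaseRatio_eq_exp (hw : IsNonrecessive w w') {b : ℂ → ℂ} {B X0 : ℝ}
    (hb : ∀ u : ℂ, X0 ≤ u.re → DifferentiableAt ℂ b u ∧ ‖b u‖ ≤ B) (X : ℝ) :
    ∃ x : ℝ, X ≤ x ∧ ∃ u : ℂ, ‖u - x‖ ≤ 1 ∧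
      phaseRatio w w' (Complex.I * freq) u = Complex.exp (b u) := by
  set τ : ℂ := Complex.I * freq with hτ_def
  have hτ : τ ^ 2 = -(freq : ℂ) ^ 2 := I_freq_sq
  have hf := freq_pos
  have hτn : ‖τ‖ = freq := by
    rw [hτ_def, norm_mul, Complex.norm_I, one_mul, Complex.norm_real, Real.norm_of_nonneg hf.le]
  have hτ0 : τ ≠ 0 := norm_pos_iff.1 (by rw [hτn]; exact hf)
  set K : ℝ := |Real.log ‖phaseRatio w w' τ 0‖| + Real.pi with hK
  have ht : Tendsto (fun x : ℝ => freq * √((x - 1) / Real.pi)) atTop atTop :=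
    tendsto_freq_mul_sqrt.comp (tendsto_atTop_add_const_right _ (-1) tendsto_id)
  -- The last condition makes the radius of the image disc below exceed K + B, where K bounds |log
  -- R(x)| for all admissible x.
  obtain ⟨x, hx6, hxX, hx0, hxK⟩ := ((eventually_ge_atTop (6 : ℝ)).and
    ((eventually_ge_atTop X).and ((eventually_ge_atTop (X0 + 2)).and
      (ht.eventually_gt_atTop (2 * (K + B) + 2 * B))))).exists
  refine ⟨x, hxX, ?_⟩
  have hball : ∀ u ∈ Metric.ball (x : ℂ) 2, moment 0 u ≠ 0 := fun u hu => by
    rw [Metric.mem_ball, dist_eq_norm] at hu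
    obtain ⟨h1, h2⟩ := mem_sector_of_dist_lt hx6 hu
    exact moment_zero_ne_zero h1 h2
  have hxb : (x : ℂ) ∈ Metric.ball (x : ℂ) 2 := Metric.mem_ball_self two_pos
  have hpd : DifferentiableOn ℂ (fun u => 2 * τ / moment 0 u) (Metric.ball (x : ℂ) 2) :=
    (differentiableOn_const _).div (differentiable_moment 0).differentiableOn hball
  -- S is a primitive of 2τ/q vanishing at x, that is, a branch of log(R/R(x)) on the disc.
  obtain ⟨S, hSx, hS⟩ := hpd.isExactOn_ball.with_val_at (x : ℂ) 0
  have hTS : ∀ u ∈ Metric.ball (x : ℂ) 2,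
      phaseRatio w w' τ u = phaseRatio w w' τ x * Complex.exp (S u) := by
    intro u hu
    have hd : ∀ y ∈ Metric.ball (x : ℂ) 2,
        HasDerivAt (fun y => phaseRatio w w' τ y * Complex.exp (-S y)) 0 y := fun y hy => by
      convert! (hw.hasDerivAt_phaseRatio hτ (hball y hy)).mul (hS y hy).neg.cexp using 1
      ring
    have := Metric.isOpen_ball.is_const_of_deriv_eq_zero (convex_ball (x : ℂ) 2).isPreconnected
      (fun y hy => (hd y hy).differentiableAt.differentiableWithinAt)
      (fun y hy => (hd y hy).deriv) hu hxb
    simp only [hSx, neg_zero, Complex.exp_zero, mul_one] at this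
    rw [← this, mul_assoc, ← Complex.exp_add, neg_add_cancel, Complex.exp_zero, mul_one]
  have hsub : Metric.closedBall (x : ℂ) 1 ⊆ Metric.ball (x : ℂ) 2 :=
    Metric.closedBall_subset_ball (by norm_num)
  have hbx : ∀ u ∈ Metric.ball (x : ℂ) 2, X0 ≤ u.re := fun u hu => by
    rw [Metric.mem_ball, dist_eq_norm] at hu
    have h1 := (Complex.abs_re_le_norm (u - x)).trans_lt hu
    rw [Complex.sub_re, Complex.ofReal_re, abs_lt] at h1
    linarith [h1.1]
  -- Along the radius in direction d, S/(2τ d) has derivative 1/q, whose real part is bounded below;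
  -- integration gives a lower bound of order √x on the unit circle.
  have hSn : ∀ u ∈ Metric.sphere (x : ℂ) 1, freq * √((x - 1) / Real.pi) ≤ ‖S u‖ := by
    intro u hu
    set d := u - x with hd
    have hdn : ‖d‖ = 1 := by rwa [mem_sphere_iff_norm] at hu
    have hd0 : d ≠ 0 := norm_pos_iff.1 (by rw [hdn]; exact one_pos)
    have hmem : ∀ t ∈ Icc (0 : ℝ) 1, ‖(x + t * d : ℂ) - x‖ ≤ 1 := fun t ht => by
      rw [add_sub_cancel_left, norm_mul, hdn, mul_one, Complex.norm_real,
        Real.norm_of_nonneg ht.1]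
      exact ht.2
    have hder : ∀ t ∈ Icc (0 : ℝ) 1, HasDerivAt (fun t : ℝ => (S (x + t * d) / (2 * τ * d)).re)
        ((moment 0 (x + t * d))⁻¹).re t := fun t ht => by
      have h1 := hasDerivAt_comp_line (s := t) (hS (x + t * d)
        (hsub (mem_closedBall_iff_norm.2 (hmem t ht))))
      have h2 := Complex.reCLM.hasFDerivAt.comp_hasDerivAt t (h1.div_const (2 * τ * d))
      convert! h2 using 1
      rw [Complex.reCLM_apply]
      congr 1
      field_simp
    have key := (convex_Icc (0 : ℝ) 1).mul_sub_le_image_sub_of_le_deriv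
      (C := 1 / 2 * √((x - 1) / Real.pi))
      (fun t ht => (hder t ht).continuousAt.continuousWithinAt)
      (fun t ht => (hder t (interior_subset ht)).differentiableAt.differentiableWithinAt)
      (fun t ht => by
        have ht' := interior_subset ht
        rw [(hder t ht').deriv]
        obtain ⟨h1, h2⟩ := mem_sector_of_dist_lt hx6 ((hmem t ht').trans_lt one_lt_two)
        refine le_trans ?_ (le_re_inv_moment_zero h1 h2)
        have h3 := (Complex.abs_re_le_norm _).trans (hmem t ht')
        rw [Complex.sub_re, Complex.ofReal_re, abs_le] at h3
        have := Real.pi_pos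
        gcongr
        linarith [h3.1]) 0 ⟨le_rfl, zero_le_one⟩ 1 ⟨zero_le_one, le_rfl⟩ zero_le_one
    have e : (x : ℂ) + d = u := by rw [hd]; ring
    simp only [sub_zero, mul_one, Complex.ofReal_zero, zero_mul, add_zero, hSx, zero_div,
      Complex.zero_re, Complex.ofReal_one, one_mul, e] at key
    have h4 := key.trans (Complex.re_le_norm _)
    rw [norm_div, norm_mul, norm_mul, hdn, hτn, Complex.norm_ofNat, mul_one,
      le_div_iff₀ (by positivity)] at h4
    linarith
  -- It remains to solve F = -log R(x). The quantitative open mapping theorem covers a disc of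
  -- radius ε/2 about F(x) = -b(x), which contains this target.
  set F : ℂ → ℂ := fun u => S u - b u with hF
  have hFd : DiffContOnCl ℂ F (Metric.ball (x : ℂ) 1) := by
    refine DifferentiableOn.diffContOnCl_ball (U := Metric.ball (x : ℂ) 2) (fun u hu => ?_) hsub
    exact ((hS u hu).differentiableAt.sub (hb u (hbx u hu)).1).differentiableWithinAt
  set ε : ℝ := freq * √((x - 1) / Real.pi) - 2 * B with hε
  have himg := hFd.ball_subset_image_closedBall (ε := ε) one_pos (fun u hu => by
    have h1 := (hb u (hbx u (hsub (Metric.sphere_subset_closedBall hu)))).2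
    have h2 := (hb x (hbx x hxb)).2
    have h3 := hSn u hu
    have e : F u - F x = S u - (b u - b x) := by simp only [hF, hSx]; ring
    rw [e]
    have h4 := norm_sub_norm_le (S u) (b u - b x)
    have h5 := norm_sub_le (b u) (b x)
    linarith) (by
      -- If F were locally constant at x, it would be constant on the disc, and |S(x + 1)| ≤ 2B
      -- would contradict the lower bound on the circle.
      by_contra hcon
      have hev : F =ᶠ[𝓝 (x : ℂ)] fun _ => F x := by
        simpa [Filter.not_frequently] using! hcon
      have hconst : ∀ u ∈ Metric.ball (x : ℂ) 2, F u = F x := by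
        have han : AnalyticOnNhd ℂ F (Metric.ball (x : ℂ) 2) :=
          DifferentiableOn.analyticOnNhd (fun u hu =>
            ((hS u hu).differentiableAt.sub (hb u (hbx u hu)).1).differentiableWithinAt)
            Metric.isOpen_ball
        exact fun u hu => han.eqOn_of_preconnected_of_eventuallyEq analyticOnNhd_const
          (convex_ball (x : ℂ) 2).isPreconnected hxb hev hu
      have hmem : (x : ℂ) + 1 ∈ Metric.sphere (x : ℂ) 1 := by simp
      have h0 := hconst _ (hsub (Metric.sphere_subset_closedBall hmem))
      have h1 := (hb _ (hbx _ (hsub (Metric.sphere_subset_closedBall hmem)))).2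
      have h2 := (hb x (hbx x hxb)).2
      have h3 := hSn _ hmem
      have e : S (x + 1) = b (x + 1) - b x := by
        simp only [hF, hSx] at h0
        linear_combination h0
      have h5 := norm_sub_le (b (x + 1)) (b x)
      rw [← e] at h5
      have hB := (norm_nonneg _).trans h2
      have : 0 ≤ K := by rw [hK]; have := Real.pi_pos; positivity
      linarith)
  have hTx : phaseRatio w w' τ x ≠ 0 := hw.phaseRatio_ne_zero hτ (hball x hxb)
  have hlog : ‖Complex.log (phaseRatio w w' τ x)‖ ≤ K := by
    refine (Complex.norm_le_abs_re_add_abs_im _).trans ?_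
    rw [Complex.log_re, Complex.log_im, hw.norm_phaseRatio_ofReal (by linarith)]
    exact add_le_add le_rfl (Complex.abs_arg_le_pi _)
  obtain ⟨u, hu, hFu⟩ := himg (show -Complex.log (phaseRatio w w' τ x) ∈
      Metric.ball (F x) (ε / 2) by
    rw [mem_ball_iff_norm]
    have e : -Complex.log (phaseRatio w w' τ x) - F x =
        b x - Complex.log (phaseRatio w w' τ x) := by simp only [hF, hSx]; ring
    rw [e]
    have h1 := norm_sub_le (b x) (Complex.log (phaseRatio w w' τ x))
    have h2 := (hb x (hbx x hxb)).2
    rw [hε]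
    linarith)
  refine ⟨u, mem_closedBall_iff_norm.1 hu, ?_⟩
  have e : S u = b u - Complex.log (phaseRatio w w' τ x) := by
    simp only [hF] at hFu
    linear_combination hFu
  rw [hTS u (hsub hu), e, Complex.exp_sub, Complex.exp_log hTx]
  field_simp

theorem infinite_of_exists_zero {P : ℂ → Prop}
    (h : ∀ X : ℝ, ∃ x : ℝ, X ≤ x ∧ ∃ u : ℂ, ‖u - x‖ ≤ 1 ∧ P (dir * u)) :
    {z : ℂ | P z ∧ 0 < z.im}.Infinite := by
  intro hfin
  obtain ⟨R, hR⟩ := hfin.isBounded.exists_norm_le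
  obtain ⟨x, hx, u, hu, hP⟩ := h (max 3 (R + 2))
  have hx3 : 3 ≤ x := (le_max_left _ _).trans hx
  have hxR : R + 2 ≤ x := (le_max_right _ _).trans hx
  have h1 := (Complex.abs_re_le_norm _).trans hu
  have h2 := (Complex.abs_im_le_norm _).trans hu
  rw [Complex.sub_re, Complex.ofReal_re, abs_le] at h1
  rw [Complex.sub_im, Complex.ofReal_im, sub_zero, abs_le] at h2
  have h3 : 1 ≤ √(3 : ℝ) := Real.one_le_sqrt.2 (by norm_num)
  have him : 0 < (dir * u).im := by
    rw [dir_mul_im]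
    nlinarith [h1.1, h2.1]
  have h4 := hR (dir * u) ⟨hP, him⟩
  rw [norm_mul, norm_dir, one_mul] at h4
  have h5 := (Complex.re_le_norm u).trans h4
  linarith [h1.1]

theorem phaseFactor_ne_zero_of_mem (hw : IsNonrecessive w w') {τ : ℂ}
    (hτ : τ ^ 2 = -(freq : ℂ) ^ 2) {x : ℝ} (hx : 6 ≤ x) {u : ℂ} (hu : ‖u - x‖ ≤ 1) :
    phaseFactor w w' τ u ≠ 0 := by
  obtain ⟨h1, h2⟩ := mem_sector_of_dist_lt hx (hu.trans_lt one_lt_two)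
  exact hw.phaseFactor_ne_zero hτ (moment_zero_ne_zero h1 h2)

/-- The two phase factors differ by 2iκ w, so the points with R = 1 = exp 0 are zeros of w. -/
theorem infinite_zeros (hw : IsNonrecessive w w') : {z : ℂ | w z = 0 ∧ 0 < z.im}.Infinite := by
  refine infinite_of_exists_zero fun X => ?_
  obtain ⟨x, hx, u, hu, h⟩ := hw.exists_phaseRatio_eq_exp (b := fun _ => 0) (B := 0) (X0 := 0)
    (fun u _ => ⟨differentiableAt_const _, by simp⟩) (max X 6)
  refine ⟨x, (le_max_left _ _).trans hx, u, hu, ?_⟩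
  have hne := hw.phaseFactor_ne_zero_of_mem (τ := -(Complex.I * freq)) (by rw [neg_sq, I_freq_sq])
    ((le_max_right _ _).trans hx) hu
  rw [Complex.exp_zero, phaseRatio, div_eq_one_iff_eq hne, phaseFactor, phaseFactor] at h
  have h2 : 2 * (Complex.I * freq) * w (dir * u) = 0 := by linear_combination h
  have hf : (freq : ℂ) ≠ 0 := by exact_mod_cast freq_pos.ne'
  simpa [hf] using h2

theorem infinite_zeros_deriv (hw : IsNonrecessive w w') :
    {z : ℂ | w' z = 0 ∧ 0 < z.im}.Infinite := by
  refine infinite_of_exists_zero fun X => ?_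
  set τ : ℂ := Complex.I * freq with hτ_def
  have hf := freq_pos
  have hτn : ‖τ‖ = freq := by
    rw [hτ_def, norm_mul, Complex.norm_I, one_mul, Complex.norm_real, Real.norm_of_nonneg hf.le]
  obtain ⟨X0, h0⟩ := exists_norm_moment_one_le (show 0 < freq / 4 by positivity)
  -- At a zero of w' the ratio must equal -(τ + q₁/2)/(τ - q₁/2) = -(1 + k), with q₁ = `moment 1 u`.
  -- Since k is small far out, πi + log(1 + k) is a bounded holomorphic logarithm of this target.
  set k : ℂ → ℂ := fun u => moment 1 u / (τ - moment 1 u / 2) with hk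
  have hden : ∀ u : ℂ, X0 ≤ u.re → 7 / 8 * freq ≤ ‖τ - moment 1 u / 2‖ := fun u hu => by
    have h1 := norm_sub_norm_le τ (moment 1 u / 2)
    rw [norm_div, Complex.norm_ofNat, hτn] at h1
    linarith [h0 u hu]
  have hden0 : ∀ u : ℂ, X0 ≤ u.re → τ - moment 1 u / 2 ≠ 0 := fun u hu =>
    norm_pos_iff.1 (lt_of_lt_of_le (by positivity) (hden u hu))
  have hkn : ∀ u : ℂ, X0 ≤ u.re → ‖k u‖ ≤ 1 / 2 := fun u hu => by
    have h1 := hden u hu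
    rw [hk, norm_div, div_le_iff₀ (lt_of_lt_of_le (by positivity) h1)]
    linarith [h0 u hu]
  have hslit : ∀ u : ℂ, X0 ≤ u.re → 1 + k u ∈ Complex.slitPlane := fun u hu =>
    Complex.mem_slitPlane_of_norm_lt_one ((hkn u hu).trans_lt (by norm_num))
  have hb : ∀ u : ℂ, X0 ≤ u.re →
      DifferentiableAt ℂ (fun u => Real.pi * Complex.I + Complex.log (1 + k u)) u ∧
      ‖Real.pi * Complex.I + Complex.log (1 + k u)‖ ≤ Real.pi + 1 := fun u hu => by
    constructor
    · have hd : DifferentiableAt ℂ k u :=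
        (differentiable_moment 1 u).div
          ((differentiableAt_const τ).sub ((differentiable_moment 1 u).div_const 2)) (hden0 u hu)
      exact ((hd.const_add 1).clog (hslit u hu)).const_add _
    · refine (norm_add_le _ _).trans ?_
      have h1 := Complex.norm_log_one_add_half_le_self (hkn u hu)
      have h2 := hkn u hu
      rw [norm_mul, Complex.norm_I, Complex.norm_real, Real.norm_of_nonneg Real.pi_pos.le]
      linarith
  obtain ⟨x, hx, u, hu, h⟩ := hw.exists_phaseRatio_eq_exp hb (max X (max 6 (X0 + 1)))
  refine ⟨x, (le_max_left _ _).trans hx, u, hu, ?_⟩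
  have hx6 : 6 ≤ x := (le_max_left _ _).trans ((le_max_right _ _).trans hx)
  have hx0 : X0 + 1 ≤ x := (le_max_right _ _).trans ((le_max_right _ _).trans hx)
  have hux : X0 ≤ u.re := by
    have h1 := (Complex.abs_re_le_norm _).trans hu
    rw [Complex.sub_re, Complex.ofReal_re, abs_le] at h1
    linarith [h1.1]
  have hne := hw.phaseFactor_ne_zero_of_mem (τ := -τ) (by rw [neg_sq, I_freq_sq]) hx6 hu
  rw [Complex.exp_add, Complex.exp_pi_mul_I,
    Complex.exp_log (Complex.slitPlane_ne_zero (hslit u hux)), phaseRatio, div_eq_iff hne] at h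
  have hd0 := hden0 u hux
  have hk1 : k u * (τ - moment 1 u / 2) = moment 1 u := div_mul_cancel₀ _ hd0
  obtain ⟨g1, g2⟩ := mem_sector_of_dist_lt hx6 (hu.trans_lt one_lt_two)
  have hm := moment_zero_ne_zero g1 g2
  have hτ0 : τ ≠ 0 := norm_pos_iff.1 (by rw [hτn]; exact hf)
  rw [phaseFactor, phaseFactor] at h
  have h2 : 2 * τ * moment 0 u * dir * w' (dir * u) = 0 := by
    linear_combination (τ - moment 1 u / 2) * h -
      (moment 0 u * (dir * w' (dir * u)) + (moment 1 u / 2 - τ) * w (dir * u)) * hk1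
  simpa [hτ0, hm, dir_ne_zero] using h2

/-- The points lie on arg u = -π/3, the edge of the sector, and r ≥ 8 gives Re u ≥ 4. There the
squared factor is the ratio for -iκ, bounded in the lower half of the sector, times the product C q,
which is bounded too. -/
theorem exists_norm_phaseFactor_le (hw : IsNonrecessive w w') : ∃ B : ℝ, ∀ r : ℝ, 8 ≤ r →
    ‖phaseFactor w w' (-(Complex.I * freq)) (starRingEnd ℂ dir * r)‖ ≤ B := by
  obtain ⟨C, -, hC⟩ := hw.exists_const I_freq_sq
  set K := ‖phaseRatio w w' ((-1 : ℝ) * (Complex.I * freq)) 0‖ with hK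
  refine ⟨K * (‖C‖ * √Real.pi) + 1, fun r hr => ?_⟩
  have h3 : √(3 : ℝ) ^ 2 = 3 := Real.sq_sqrt (by norm_num)
  set u := starRingEnd ℂ dir * r with hu
  have hure : u.re = r / 2 := by rw [hu, conj_dir_mul_re]; simp; ring
  have hune : ‖u‖ = r := by
    rw [hu, norm_conj_dir_mul, Complex.norm_real, Real.norm_of_nonneg (by linarith)]
  have e : (((r / 2 : ℝ) : ℂ) + ((√3 / 2 * r : ℝ) : ℂ) * (((-1 : ℝ) : ℂ) * Complex.I)) = u := by
    apply Complex.ext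
    · rw [hure]; simp
    · simp [hu, Complex.mul_im, dir_im]
  have h1 := hw.norm_phaseRatio_vertical_le (σ := -1) (x := r / 2) (y := √3 / 2 * r) (by norm_num)
    (by linarith) (by positivity) (by rw [e, hune]; linarith)
  rw [e] at h1
  have hm : moment 0 u ≠ 0 :=
    moment_zero_ne_zero (by rw [hure]; linarith) (by rw [hure, hune]; linarith)
  have h2 : ‖phaseRatio w w' (-(Complex.I * freq)) u‖ ≤ K := by
    have hexp : Real.exp (-(freq * √(r / 2 / Real.pi) * (√3 / 2 * r))) ≤ 1 := by
      rw [Real.exp_le_one_iff, neg_nonpos]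
      have := freq_pos
      positivity
    calc _ = ‖phaseRatio w w' ((-1 : ℝ) * (Complex.I * freq)) u‖ := by
          rw [Complex.ofReal_neg, Complex.ofReal_one, neg_one_mul]
      _ ≤ _ := h1
      _ ≤ 1 * K := by gcongr
      _ = K := one_mul K
  have hne := hw.phaseFactor_ne_zero I_freq_sq hm
  have hq : ‖moment 0 u‖ ≤ √Real.pi := by
    refine (norm_moment_zero_le (by rw [hure]; linarith)).trans ?_
    have := Real.pi_pos
    gcongr
    rw [hure]
    exact div_le_self this.le (by linarith)
  have hsq : phaseFactor w w' (-(Complex.I * freq)) u ^ 2 =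
      phaseRatio w w' (-(Complex.I * freq)) u * (C * moment 0 u) := by
    rw [← hC u, phaseRatio, neg_neg]
    field_simp
  have hle : ‖phaseFactor w w' (-(Complex.I * freq)) u‖ ^ 2 ≤ K * (‖C‖ * √Real.pi) := by
    rw [← norm_pow, hsq, norm_mul, norm_mul]
    gcongr
  nlinarith [sq_nonneg (‖phaseFactor w w' (-(Complex.I * freq)) u‖ - 1)]

end IsNonrecessive

theorem re_eq_zero_of_sq_eq {τ : ℂ} (hτ : τ ^ 2 = -(freq : ℂ) ^ 2) : τ.re = 0 := by
  have h : (τ - Complex.I * freq) * (τ + Complex.I * freq) = 0 := by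
    linear_combination hτ - (freq : ℂ) ^ 2 * Complex.I_sq
  rcases mul_eq_zero.1 h with h | h
  · rw [sub_eq_zero.1 h]; simp
  · rw [eq_neg_of_add_eq_zero_left h]; simp

/-- As τ is imaginary, the real part of the phase factor at 0 does not involve it. The dependence on
a cancels as well, leaving a nonzero constant. -/
theorem isNonrecessive_V (a : ℝ) : IsNonrecessive (V a) (deriv (V a)) where
  toIsAirySolution := isAirySolution_V a
  phaseFactor_zero_ne_zero τ hτ h := by
    have h1 : (phaseFactor (V a) (deriv (V a)) τ 0).re = -(√3 * (ai0' * momentZero 0)) := by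
      rw [phaseFactor, mul_zero, moment_zero, moment_zero, V_zero, deriv_V_zero, Complex.add_re,
        Complex.re_ofReal_mul, Complex.re_mul_ofReal, Complex.re_mul_ofReal, Complex.add_re,
        re_eq_zero_of_sq_eq hτ, dir_re,
        show ((momentZero 1 : ℂ) / 2) = ((momentZero 1 / 2 : ℝ) : ℂ) by push_cast; rfl,
        Complex.ofReal_re]
      linear_combination (a + √3) / 2 * ai0'_mul_momentZero
    rw [h, Complex.zero_re] at h1
    have h3 : 0 < √(3 : ℝ) := by positivity
    exact (neg_pos.2 (mul_neg_of_pos_of_neg h3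
      (mul_neg_of_neg_of_pos ai0'_neg (momentZero_pos 0)))).ne h1

/-- The factor of Ai for τ = iκ vanishes at 0, hence, by the product identity with a nonvanishing
factor of V_0, throughout the sector. So Ai is a constant multiple of its other factor, bounded as a
difference of those of V_1 and V_0. -/
theorem exists_norm_Ai_le : ∃ B : ℝ, ∀ r : ℝ, 8 ≤ r → ‖Ai r‖ ≤ B := by
  obtain ⟨B0, h0⟩ := (isNonrecessive_V 0).exists_norm_phaseFactor_le
  obtain ⟨B1, h1⟩ := (isNonrecessive_V 1).exists_norm_phaseFactor_le
  set v' : ℂ → ℂ := fun z => deriv (V 1) z + -1 * deriv (V 0) z with hv'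
  have hAi : Ai = fun z => V 1 z + -1 * V 0 z := by funext z; simp [V]
  have hv : IsAirySolution Ai v' := by
    rw [hAi]
    exact (isAirySolution_V 1).add ((isAirySolution_V 0).const_mul (-1))
  set τ : ℂ := Complex.I * freq with hτ_def
  have hf := freq_pos
  obtain ⟨C, hC⟩ := hv.exists_phaseFactor_mul (isAirySolution_V 0) (τ := τ) I_freq_sq
  have hz : phaseFactor Ai v' τ 0 = 0 := by
    have e1 : v' 0 = (ai0' : ℂ) := by
      simp only [hv', deriv_V_zero]; push_cast; ring
    have e2 : Ai 0 = (ai0 : ℂ) := by simp [Ai, phi1_zero]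
    have e3 : (momentZero 1 : ℂ) / 2 + τ = momentZero 1 * dir := by
      rw [hτ_def, freq]
      apply Complex.ext
      · simp [dir_re]; ring
      · simp [dir_im]; ring
    rw [phaseFactor, mul_zero, moment_zero, moment_zero, e1, e2, e3]
    have e4 : (ai0' : ℂ) * momentZero 0 = -(ai0 * momentZero 1) := by
      exact_mod_cast ai0'_mul_momentZero
    linear_combination dir * e4
  have hC0 : C = 0 := by
    have := hC 0
    rw [hz, zero_mul, moment_zero] at this
    have hm : (momentZero 0 : ℂ) ≠ 0 := by exact_mod_cast (momentZero_pos 0).ne'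
    simpa [hm] using this.symm
  refine ⟨(B1 + B0) / (2 * freq), fun r hr => ?_⟩
  have a0 := h0 r hr
  have a1 := h1 r hr
  set u := starRingEnd ℂ dir * r with hu
  have hdu : dir * u = r := dir_mul_conj_dir_mul _
  have hure : u.re = r / 2 := by rw [hu, conj_dir_mul_re]; simp; ring
  have hune : ‖u‖ = r := by
    rw [hu, norm_conj_dir_mul, Complex.norm_real, Real.norm_of_nonneg (by linarith)]
  have hm : moment 0 u ≠ 0 :=
    moment_zero_ne_zero (by rw [hure]; linarith) (by rw [hure, hune]; linarith)
  have hp : phaseFactor Ai v' τ u = 0 := by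
    have := hC u
    rw [hC0, zero_mul] at this
    exact (mul_eq_zero.1 this).resolve_right ((isNonrecessive_V 0).phaseFactor_ne_zero
      (by rw [neg_sq, I_freq_sq]) hm)
  have hAr : 2 * τ * Ai r = -(phaseFactor (V 1) (deriv (V 1)) (-τ) u -
      phaseFactor (V 0) (deriv (V 0)) (-τ) u) := by
    rw [← hdu]
    simp only [phaseFactor, hv', hAi] at hp ⊢
    linear_combination hp
  have hn := congrArg norm hAr
  rw [norm_neg, norm_mul, norm_mul, hτ_def, norm_mul, Complex.norm_I, Complex.norm_real,
    Real.norm_of_nonneg hf.le, Complex.norm_ofNat, one_mul] at hn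
  have := norm_sub_le (phaseFactor (V 1) (deriv (V 1)) (-τ) u)
    (phaseFactor (V 0) (deriv (V 0)) (-τ) u)
  rw [le_div_iff₀ (by positivity)]
  linarith

/-! ### Zeros on the real axis -/

section RealSolutions

variable {f f' : ℝ → ℝ}

/-- A positive solution on (-∞, X] is concave. A positive slope anywhere would drive it to zero
further left, so the slope is nonpositive and f ≥ f(X). Then f'' ≤ -f(X), and the slope becomes
positive far to the left. -/
theorem not_pos_of_real_airy (hf : ∀ x, HasDerivAt f (f' x) x)
    (hf' : ∀ x, HasDerivAt f' (x * f x) x) {X : ℝ} (hX : X ≤ -1) : ¬∀ x ≤ X, 0 < f x := by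
  intro hpos
  have hanti : AntitoneOn f' (Iic X) := by
    refine antitoneOn_of_deriv_nonpos (convex_Iic X)
      (fun x _ => (hf' x).continuousAt.continuousWithinAt)
      (fun x _ => (hf' x).differentiableAt.differentiableWithinAt) fun x hx => ?_
    have hx' : x ≤ X := mem_Iic.1 (interior_subset hx)
    rw [(hf' x).deriv]
    exact mul_nonpos_of_nonpos_of_nonneg (by linarith) (hpos x hx').le
  have hnonpos : ∀ x ≤ X, f' x ≤ 0 := by
    intro x0 hx0
    by_contra! hc
    -- Where the tangent line at x0 meets zero.
    set x1 := x0 - f x0 / f' x0 with hx1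
    have h10 : x1 ≤ x0 := by
      have := div_pos (hpos x0 hx0) hc
      linarith
    have := (convex_Iic x0).mul_sub_le_image_sub_of_le_deriv (C := f' x0)
      (fun x _ => (hf x).continuousAt.continuousWithinAt)
      (fun x _ => (hf x).differentiableAt.differentiableWithinAt) (fun x hx => by
        have hx' : x ≤ x0 := mem_Iic.1 (interior_subset hx)
        rw [(hf x).deriv]
        exact hanti (hx'.trans hx0) hx0 hx') x1 h10 x0 (mem_Iic.2 le_rfl) h10
    have e : f' x0 * (x0 - x1) = f x0 := by rw [hx1]; field_simp; ring
    have := hpos x1 (h10.trans hx0)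
    linarith
  have hfanti : AntitoneOn f (Iic X) := by
    refine antitoneOn_of_deriv_nonpos (convex_Iic X)
      (fun x _ => (hf x).continuousAt.continuousWithinAt)
      (fun x _ => (hf x).differentiableAt.differentiableWithinAt) fun x hx => ?_
    rw [(hf x).deriv]
    exact hnonpos x (mem_Iic.1 (interior_subset hx))
  have hc := hpos X le_rfl
  -- Chosen so that the bound on f'' forces f' ≥ 1 at this point.
  set x1 := X - (1 - f' X) / f X with hx1
  have h1X : x1 ≤ X := by
    have := div_pos (show 0 < 1 - f' X by linarith [hnonpos X le_rfl]) hc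
    linarith
  have := (convex_Iic X).image_sub_le_mul_sub_of_deriv_le (C := -f X)
    (fun x _ => (hf' x).continuousAt.continuousWithinAt)
    (fun x _ => (hf' x).differentiableAt.differentiableWithinAt) (fun x hx => by
      have hx' : x ≤ X := mem_Iic.1 (interior_subset hx)
      rw [(hf' x).deriv]
      have h1 : f X ≤ f x := hfanti (mem_Iic.2 hx') (mem_Iic.2 le_rfl) hx'
      nlinarith) x1 h1X X (mem_Iic.2 le_rfl) h1X
  have e : f X * (X - x1) = 1 - f' X := by rw [hx1]; field_simp; ring
  have := hnonpos x1 h1X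
  linarith

theorem exists_zero_lt_of_real_airy (hf : ∀ x, HasDerivAt f (f' x) x)
    (hf' : ∀ x, HasDerivAt f' (x * f x) x) (X : ℝ) : ∃ x < X, f x = 0 := by
  by_contra! hne
  set Y := min (-1) (X - 1) with hY
  have hY1 : Y ≤ -1 := min_le_left _ _
  have hYX : Y < X := (min_le_right _ _).trans_lt (by linarith)
  have hcont : ContinuousOn f (Iic Y) := fun x _ => (hf x).continuousAt.continuousWithinAt
  have hsign : ∀ x ≤ Y, 0 < f x * f Y := by
    intro x hx
    rcases (hne Y hYX).lt_or_gt with h | h <;> rcases (hne x (hx.trans_lt hYX)).lt_or_gt with h' | h'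
    · exact mul_pos_of_neg_of_neg h' h
    · obtain ⟨y, hy, hy0⟩ := isPreconnected_Iic.intermediate_value (mem_Iic.2 le_rfl) (mem_Iic.2 hx)
        hcont ⟨h.le, h'.le⟩
      exact absurd hy0 (hne y ((mem_Iic.1 hy).trans_lt hYX))
    · obtain ⟨y, hy, hy0⟩ := isPreconnected_Iic.intermediate_value (mem_Iic.2 hx) (mem_Iic.2 le_rfl)
        hcont ⟨h'.le, h.le⟩
      exact absurd hy0 (hne y ((mem_Iic.1 hy).trans_lt hYX))
    · exact mul_pos h' h
  -- Multiplication by f(Y) normalises the sign without leaving the equation.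
  refine not_pos_of_real_airy (f := fun x => f x * f Y) (f' := fun x => f' x * f Y)
    (fun x => (hf x).mul_const _) (fun x => ?_) hY1 hsign
  convert! (hf' x).mul_const (f Y) using 1
  ring

theorem exists_deriv_zero_lt_of_real_airy (hf : ∀ x, HasDerivAt f (f' x) x)
    (hf' : ∀ x, HasDerivAt f' (x * f x) x) (X : ℝ) : ∃ x < X, f' x = 0 := by
  obtain ⟨x1, h1, hx1⟩ := exists_zero_lt_of_real_airy hf hf' X
  obtain ⟨x2, h2, hx2⟩ := exists_zero_lt_of_real_airy hf hf' x1
  obtain ⟨c, hc, hc0⟩ := exists_hasDerivAt_eq_zero h2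
    (fun x _ => (hf x).continuousAt.continuousWithinAt) (by rw [hx1, hx2]) (fun x _ => hf x)
  exact ⟨c, hc.2.trans h1, hc0⟩

end RealSolutions

/-- The restriction of `V a` to the real axis. -/
noncomputable def realV (a x : ℝ) : ℝ := (V a x).re

/-- The derivative of `V a` on the real axis. -/
noncomputable def realV' (a x : ℝ) : ℝ := (deriv (V a) x).re

theorem V_ofReal (a x : ℝ) : V a x = (realV a x : ℂ) :=
  Complex.ext rfl (V_ofReal_im a x)

theorem deriv_V_ofReal (a x : ℝ) : deriv (V a) x = (realV' a x : ℂ) :=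
  Complex.ext rfl (deriv_V_ofReal_im a x)

theorem V_ofReal_eq_zero_iff (a x : ℝ) : V a x = 0 ↔ realV a x = 0 := by
  rw [V_ofReal, Complex.ofReal_eq_zero]

theorem deriv_V_ofReal_eq_zero_iff (a x : ℝ) : deriv (V a) x = 0 ↔ realV' a x = 0 := by
  rw [deriv_V_ofReal, Complex.ofReal_eq_zero]

theorem hasDerivAt_realV (a x : ℝ) : HasDerivAt (realV a) (realV' a x) x :=
  ((isAirySolution_V a).hasDerivAt x).real_of_complex

theorem hasDerivAt_realV' (a x : ℝ) : HasDerivAt (realV' a) (x * realV a x) x := by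
  convert! ((isAirySolution_V a).hasDerivAt_deriv x).real_of_complex using 1
  rw [Complex.re_ofReal_mul, realV]

theorem realV_zero (a : ℝ) : realV a 0 = ai0 * (a + √3) := by
  rw [realV, Complex.ofReal_zero, V_zero, Complex.ofReal_re]

theorem realV'_zero (a : ℝ) : realV' a 0 = ai0' * (a - √3) := by
  rw [realV', Complex.ofReal_zero, deriv_V_zero, Complex.ofReal_re]

theorem infinite_of_forall_exists_lt {S : Set ℂ} (h : ∀ X : ℝ, ∃ x < X, (x : ℂ) ∈ S) :
    S.Infinite := by
  intro hfin
  obtain ⟨R, hR⟩ := hfin.isBounded.exists_norm_le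
  obtain ⟨x, hx, hS⟩ := h (-R)
  have := hR x hS
  rw [Complex.norm_real, Real.norm_eq_abs] at this
  linarith [neg_le_abs x]

theorem negZeros_V_infinite (a : ℝ) : (negZeros (V a)).Infinite :=
  infinite_of_forall_exists_lt fun X => by
    obtain ⟨x, hx, h⟩ := exists_zero_lt_of_real_airy (hasDerivAt_realV a) (hasDerivAt_realV' a)
      (min X 0)
    exact ⟨x, hx.trans_le (min_le_left _ _), (V_ofReal_eq_zero_iff a x).2 h, Complex.ofReal_im x,
      hx.trans_le (min_le_right _ _)⟩

theorem negZeros_deriv_V_infinite (a : ℝ) : (negZeros (deriv (V a))).Infinite :=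
  infinite_of_forall_exists_lt fun X => by
    obtain ⟨x, hx, h⟩ := exists_deriv_zero_lt_of_real_airy (hasDerivAt_realV a)
      (hasDerivAt_realV' a) (min X 0)
    exact ⟨x, hx.trans_le (min_le_left _ _), (deriv_V_ofReal_eq_zero_iff a x).2 h,
      Complex.ofReal_im x, hx.trans_le (min_le_right _ _)⟩

/-- The derivative is V'² + x V², positive for x > 0 because V and V' have no common zero. -/
theorem strictMonoOn_realV_mul (a : ℝ) :
    StrictMonoOn (fun x => realV a x * realV' a x) (Ici 0) := by
  have hd := fun x => (hasDerivAt_realV a x).mul (hasDerivAt_realV' a x)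
  refine strictMonoOn_of_deriv_pos (convex_Ici 0)
    (fun x _ => (hd x).continuousAt.continuousWithinAt) fun x hx => ?_
  rw [interior_Ici] at hx
  have e := (hd x).deriv
  simp only [Pi.mul_def] at e
  rw [e]
  have hx0 : 0 < x := hx
  by_cases h : realV a x = 0
  · have : realV' a x ≠ 0 := by
      rw [← V_ofReal_eq_zero_iff] at h
      exact fun h' => deriv_V_ne_zero h ((deriv_V_ofReal_eq_zero_iff a x).2 h')
    rw [h]
    have := mul_self_pos.2 this
    linarith
  · have h1 := mul_self_nonneg (realV' a x)
    have h2 := mul_pos hx0 (mul_self_pos.2 h)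
    linarith

theorem realV_mul_zero (a : ℝ) : realV a 0 * realV' a 0 = ai0 * ai0' * (a ^ 2 - 3) := by
  rw [realV_zero, realV'_zero]
  have : √(3 : ℝ) * √3 = 3 := Real.mul_self_sqrt (by norm_num)
  linear_combination -(ai0 * ai0') * this

theorem realV_mul_pos {a : ℝ} (ha : a ^ 2 ≤ 3) {x : ℝ} (hx : 0 < x) :
    0 < realV a x * realV' a x := by
  have h := strictMonoOn_realV_mul a (mem_Ici.2 le_rfl) (mem_Ici.2 hx.le) hx
  simp only [realV_mul_zero] at h
  have := mul_nonneg_of_nonpos_of_nonpos ai0_mul_ai0'_neg.le (sub_nonpos.2 ha)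
  linarith

/-- V_0 has positive value and slope at 0, so it stays positive and convex on [0, ∞) and grows at
least linearly, while a Ai is bounded on [8, ∞). -/
theorem exists_lt_realV (a M : ℝ) : ∃ x : ℝ, 0 < x ∧ M < realV a x := by
  have h3 : 0 < √(3 : ℝ) := by positivity
  have h0 : 0 < realV 0 0 := by
    rw [realV_zero]; have := ai0_pos; positivity
  have h0' : 0 < realV' 0 0 := by
    rw [realV'_zero]; exact mul_pos_of_neg_of_neg ai0'_neg (by linarith)
  have hcont : ContinuousOn (realV 0) (Ici 0) :=
    fun x _ => (hasDerivAt_realV 0 x).continuousAt.continuousWithinAt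
  have hpos : ∀ x ∈ Ici (0 : ℝ), 0 < realV 0 x := by
    intro x hx
    by_contra! hneg
    obtain ⟨y, hy, hy0⟩ := isPreconnected_Ici.intermediate_value hx (mem_Ici.2 le_rfl) hcont
      ⟨hneg, h0.le⟩
    rcases (mem_Ici.1 hy).eq_or_lt with h | h
    · rw [← h] at hy0; exact h0.ne' hy0
    · have := realV_mul_pos (a := 0) (by norm_num) h
      rw [hy0, zero_mul] at this
      exact this.false
  have hmono : MonotoneOn (realV' 0) (Ici 0) := by
    refine monotoneOn_of_deriv_nonneg (convex_Ici 0)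
      (fun x _ => (hasDerivAt_realV' 0 x).continuousAt.continuousWithinAt)
      (fun x _ => (hasDerivAt_realV' 0 x).differentiableAt.differentiableWithinAt) fun x hx => ?_
    have hx' := interior_subset hx
    rw [(hasDerivAt_realV' 0 x).deriv]
    exact mul_nonneg hx' (hpos x hx').le
  have hgrow : ∀ x : ℝ, 0 ≤ x → realV' 0 0 * x ≤ realV 0 x := by
    intro x hx
    have := (convex_Ici (0 : ℝ)).mul_sub_le_image_sub_of_le_deriv (C := realV' 0 0) hcont
      (fun x _ => (hasDerivAt_realV 0 x).differentiableAt.differentiableWithinAt) (fun x hx => by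
        have hx' := interior_subset hx
        rw [(hasDerivAt_realV 0 x).deriv]
        exact hmono (mem_Ici.2 le_rfl) hx' hx') 0 (mem_Ici.2 le_rfl) x hx hx
    linarith [sub_zero x ▸ this]
  obtain ⟨B, hB⟩ := exists_norm_Ai_le
  set x := max 8 ((M + |a| * B + 1) / realV' 0 0) with hx
  have hx8 : 8 ≤ x := le_max_left _ _
  have hx1 : M + |a| * B + 1 ≤ realV' 0 0 * x := by
    have := le_max_right 8 ((M + |a| * B + 1) / realV' 0 0)
    rw [← hx, div_le_iff₀ h0'] at this
    linarith
  refine ⟨x, by linarith, ?_⟩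
  have e : V a x = a * Ai x + V 0 x := by simp [V]
  have e2 : realV a x = a * (Ai x).re + realV 0 x := by
    rw [realV, e, Complex.add_re, Complex.re_ofReal_mul, realV]
  have h4 : |a * (Ai x).re| ≤ |a| * B := by
    rw [abs_mul]
    gcongr
    exact (Complex.abs_re_le_norm _).trans (hB x hx8)
  have := neg_abs_le (a * (Ai x).re)
  have := hgrow x (by linarith)
  linarith

theorem ofReal_of_im_eq_zero {z : ℂ} (h : z.im = 0) : z = (z.re : ℂ) :=
  Complex.ext rfl (by simpa using h)

theorem eq_of_realV_mul_eq_zero {a x y : ℝ} (hx : 0 ≤ x) (hy : 0 ≤ y)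
    (h1 : realV a x * realV' a x = 0) (h2 : realV a y * realV' a y = 0) : x = y :=
  (strictMonoOn_realV_mul a).injOn hx hy (h1.trans h2.symm)

/-- V' is negative at 0, and since V later exceeds V(0), the mean value theorem yields a point with
V' > 0. Injectivity of V V' on [0, ∞) gives uniqueness and excludes zeros of V. -/
theorem exists_pos_deriv_zero {a : ℝ} (ha : √3 < a) : ∃ x : ℝ, 0 < x ∧
    (∀ y : ℝ, 0 ≤ y → (deriv (V a) y = 0 ↔ y = x)) ∧ ∀ y : ℝ, 0 ≤ y → V a y ≠ 0 := by
  have h0' : realV' a 0 < 0 := by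
    rw [realV'_zero]; exact mul_neg_of_neg_of_pos ai0'_neg (by linarith)
  obtain ⟨x1, hx1, hlt⟩ := exists_lt_realV a (realV a 0)
  obtain ⟨ξ, hξ, hξe⟩ := exists_hasDerivAt_eq_slope (realV a) (realV' a) hx1
    (fun x _ => (hasDerivAt_realV a x).continuousAt.continuousWithinAt)
    (fun x _ => hasDerivAt_realV a x)
  have hξ0 : 0 < realV' a ξ := by
    rw [hξe]; exact div_pos (by linarith) (by linarith)
  obtain ⟨x, hx, hx0⟩ := intermediate_value_Icc hξ.1.le
    (fun x _ => (hasDerivAt_realV' a x).continuousAt.continuousWithinAt) ⟨h0'.le, hξ0.le⟩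
  have hxpos : 0 < x := by
    refine lt_of_le_of_ne hx.1 ?_
    rintro rfl
    exact h0'.ne hx0
  have hVx : realV a x ≠ 0 := fun h => by
    rw [← deriv_V_ofReal_eq_zero_iff] at hx0
    exact V_ne_zero_of_deriv hx0 ((V_ofReal_eq_zero_iff a x).2 h)
  refine ⟨x, hxpos, fun y hy => ?_, fun y hy h => ?_⟩
  · rw [deriv_V_ofReal_eq_zero_iff]
    refine ⟨fun h => ?_, fun h => h ▸ hx0⟩
    exact eq_of_realV_mul_eq_zero (a := a) hy hxpos.le (by rw [h, mul_zero]) (by rw [hx0, mul_zero])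
  · rw [V_ofReal_eq_zero_iff] at h
    have := eq_of_realV_mul_eq_zero (a := a) hy hxpos.le (by rw [h, zero_mul])
      (by rw [hx0, mul_zero])
    exact hVx (this ▸ h)

theorem exists_pos_zero {a : ℝ} (ha : a < -√3) : ∃ x : ℝ, 0 < x ∧
    (∀ y : ℝ, 0 ≤ y → (V a y = 0 ↔ y = x)) ∧ ∀ y : ℝ, 0 ≤ y → deriv (V a) y ≠ 0 := by
  have h0 : realV a 0 < 0 := by
    rw [realV_zero]; exact mul_neg_of_pos_of_neg ai0_pos (by linarith)
  obtain ⟨x1, hx1, hlt⟩ := exists_lt_realV a 0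
  obtain ⟨x, hx, hx0⟩ := intermediate_value_Icc hx1.le
    (fun x _ => (hasDerivAt_realV a x).continuousAt.continuousWithinAt) ⟨h0.le, hlt.le⟩
  have hxpos : 0 < x := by
    refine lt_of_le_of_ne hx.1 ?_
    rintro rfl
    exact h0.ne hx0
  have hVx : realV' a x ≠ 0 := fun h => by
    rw [← V_ofReal_eq_zero_iff] at hx0
    exact deriv_V_ne_zero hx0 ((deriv_V_ofReal_eq_zero_iff a x).2 h)
  refine ⟨x, hxpos, fun y hy => ?_, fun y hy h => ?_⟩
  · rw [V_ofReal_eq_zero_iff]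
    refine ⟨fun h => ?_, fun h => h ▸ hx0⟩
    exact eq_of_realV_mul_eq_zero (a := a) hy hxpos.le (by rw [h, zero_mul]) (by rw [hx0, zero_mul])
  · rw [deriv_V_ofReal_eq_zero_iff] at h
    have := eq_of_realV_mul_eq_zero (a := a) hy hxpos.le (by rw [h, mul_zero])
      (by rw [hx0, zero_mul])
    exact hVx (this ▸ h)

theorem V_ofReal_ne_zero {a : ℝ} (ha : a ^ 2 ≤ 3) {x : ℝ} (hx : 0 < x) : V a x ≠ 0 := by
  rw [Ne, V_ofReal_eq_zero_iff]
  exact left_ne_zero_of_mul (realV_mul_pos ha hx).ne'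

theorem deriv_V_ofReal_ne_zero {a : ℝ} (ha : a ^ 2 ≤ 3) {x : ℝ} (hx : 0 < x) :
    deriv (V a) x ≠ 0 := by
  rw [Ne, deriv_V_ofReal_eq_zero_iff]
  exact right_ne_zero_of_mul (realV_mul_pos ha hx).ne'

/-! ### Assembling the zero patterns -/

/-- Conjugation symmetry reduces a case of the theorem to the zeros in the open upper half-plane and
those on [0, ∞). -/
theorem sectorZeroPattern_of {f : ℂ → ℂ} {α β : ℝ} {E : Set ℂ}
    (hconj : ∀ z, f (starRingEnd ℂ z) = starRingEnd ℂ (f z)) (hneg : (negZeros f).Infinite)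
    (hinf : {z : ℂ | f z = 0 ∧ 0 < z.im}.Infinite)
    (hup : ∀ z : ℂ, 0 < z.im → f z = 0 → z.arg ∈ Ioo α β)
    (hreal : ∀ x : ℝ, 0 ≤ x → (f x = 0 ↔ (x : ℂ) ∈ E)) (hE : ∀ z ∈ E, z.im = 0 ∧ 0 ≤ z.re) :
    SectorZeroPattern f α β E := by
  have hmem : ∀ z : ℂ, 0 < z.im → f z = 0 → z ∈ sectorZeros f α β := fun z hz h =>
    ⟨h, by rintro rfl; simp at hz, hup z hz h⟩
  refine ⟨hneg, hinf.mono fun z hz => hmem z hz.2 hz.1, Set.ext fun z => ⟨fun h => ?_, ?_⟩⟩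
  · rcases lt_trichotomy z.im 0 with hz | hz | hz
    · refine Or.inl (Or.inr ⟨starRingEnd ℂ z, hmem _ (by simpa using hz) ?_, Complex.conj_conj z⟩)
      rw [hconj, show f z = 0 from h, map_zero]
    · rcases lt_or_ge z.re 0 with hr | hr
      · exact Or.inl (Or.inl (Or.inl ⟨h, hz, hr⟩))
      · right
        have e := ofReal_of_im_eq_zero hz
        rw [e, ← hreal _ hr, ← e]
        exact h
    · exact Or.inl (Or.inl (Or.inr (hmem z hz h)))
  · rintro (((h | h) | ⟨y, h, rfl⟩) | h)
    · exact h.1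
    · exact h.1
    · change f (starRingEnd ℂ y) = 0
      rw [hconj, h.1, map_zero]
    · obtain ⟨h1, h2⟩ := hE z h
      have e := ofReal_of_im_eq_zero h1
      rw [e] at h ⊢
      exact (hreal _ h2).2 h

theorem rot_neg_rot (φ : ℝ) (z : ℂ) : rot (-φ) (rot φ z) = z := by
  rw [rot, rot, ← mul_assoc, ← Complex.exp_add]
  simp

/-- Rotation by φ carries the ray arg z = θ onto the negative semiaxis and preserves the zero set.
-/
theorem rayZeros_eq {f : ℂ → ℂ} {θ φ : ℝ} (hθ : θ ∈ Ioc (-Real.pi) Real.pi)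
    (h : Complex.exp (((θ + φ : ℝ) : ℂ) * Complex.I) = -1)
    (hrot : ∀ z, f (rot φ z) = 0 ↔ f z = 0) : rayZeros f θ = rot (-φ) '' negZeros f := by
  have key : ∀ r : ℝ, rot φ (r * Complex.exp (θ * Complex.I)) = ((-r : ℝ) : ℂ) := fun r => by
    rw [rot, mul_left_comm, ← Complex.exp_add, ← add_mul, ← Complex.ofReal_add, add_comm φ, h]
    push_cast; ring
  ext z
  constructor
  · rintro ⟨hz, hz0, harg⟩
    have e : z = ‖z‖ * Complex.exp (θ * Complex.I) := by
      rw [← harg, Complex.norm_mul_exp_arg_mul_I]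
    refine ⟨rot φ z, ⟨(hrot z).2 hz, ?_, ?_⟩, rot_neg_rot φ z⟩
    · rw [e, key, Complex.ofReal_im]
    · rw [e, key, Complex.ofReal_re]
      exact neg_neg_of_pos (norm_pos_iff.2 hz0)
  · rintro ⟨y, ⟨hy, him, hre⟩, rfl⟩
    have e : rot φ (((-y.re : ℝ) : ℂ) * Complex.exp (θ * Complex.I)) = y := by
      rw [key, neg_neg]
      exact (ofReal_of_im_eq_zero him).symm
    have e2 : rot (-φ) y = ((-y.re : ℝ) : ℂ) * Complex.exp (θ * Complex.I) := by
      rw [← e, rot_neg_rot, e]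
    have hpos : 0 < -y.re := neg_pos.2 hre
    rw [e2]
    refine ⟨?_, mul_ne_zero (by exact_mod_cast hpos.ne') (Complex.exp_ne_zero _), ?_⟩
    · rw [← hrot, e]; exact hy
    · rw [Complex.exp_mul_I]
      exact Complex.arg_mul_cos_add_sin_mul_I hpos hθ

theorem exp_two_pi_div_three_cube :
    Complex.exp (((2 * Real.pi / 3 : ℝ) : ℂ) * Complex.I) ^ 3 = 1 := by
  rw [← Complex.exp_nat_mul, ← Complex.exp_two_pi_mul_I]
  congr 1
  push_cast
  ring

theorem rayZeroPattern_of {f : ℂ → ℂ} {E : Set ℂ}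
    (hconj : ∀ z, f (starRingEnd ℂ z) = starRingEnd ℂ (f z)) (hneg : (negZeros f).Infinite)
    (hrot : ∀ c : ℂ, c ^ 3 = 1 → ∀ z, f (c * z) = 0 ↔ f z = 0)
    (hup : ∀ z : ℂ, 0 < z.im → f z = 0 → z.arg = Real.pi / 3)
    (hreal : ∀ x : ℝ, 0 ≤ x → (f x = 0 ↔ (x : ℂ) ∈ E)) (hE : ∀ z ∈ E, z.im = 0 ∧ 0 ≤ z.re) :
    RayZeroPattern f E := by
  have hπ := Real.pi_pos
  have hmem : ∀ z : ℂ, 0 < z.im → f z = 0 → z ∈ rayZeros f (Real.pi / 3) := fun z hz h =>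
    ⟨h, by rintro rfl; simp at hz, hup z hz h⟩
  refine ⟨hneg, rayZeros_eq ⟨by linarith, by linarith⟩ ?_ (fun z => hrot _ ?_ z), ?_,
    Set.ext fun z => ⟨fun h => ?_, ?_⟩⟩
  · rw [show Real.pi / 3 + 2 * Real.pi / 3 = Real.pi by ring, Complex.exp_pi_mul_I]
  · exact exp_two_pi_div_three_cube
  · rw [rayZeros_eq (φ := -(2 * Real.pi / 3)) ⟨by linarith, by linarith⟩ ?_
      (fun z => hrot _ ?_ z), neg_neg]
    · rw [show -(Real.pi / 3) + -(2 * Real.pi / 3) = -Real.pi by ring, Complex.ofReal_neg, neg_mul,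
        Complex.exp_neg, Complex.exp_pi_mul_I]
      norm_num
    · rw [Complex.ofReal_neg, neg_mul, Complex.exp_neg, inv_pow, exp_two_pi_div_three_cube, inv_one]
  · rcases lt_trichotomy z.im 0 with hz | hz | hz
    · refine Or.inl (Or.inr ⟨h, by rintro rfl; simp at hz, ?_⟩)
      have h1 := hup (starRingEnd ℂ z) (by simpa using hz)
        (by rw [hconj, show f z = 0 from h, map_zero])
      rw [Complex.arg_conj] at h1
      split_ifs at h1 with h2 <;> linarith
    · rcases lt_or_ge z.re 0 with hr | hr
      · exact Or.inl (Or.inl (Or.inl ⟨h, hz, hr⟩))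
      · right
        have e := ofReal_of_im_eq_zero hz
        rw [e, ← hreal _ hr, ← e]
        exact h
    · exact Or.inl (Or.inl (Or.inr (hmem z hz h)))
  · rintro (((h | h) | h) | h)
    · exact h.1
    · exact h.1
    · exact h.1
    · obtain ⟨h1, h2⟩ := hE z h
      have e := ofReal_of_im_eq_zero h1
      rw [e] at h ⊢
      exact (hreal _ h2).2 h

/-- The coefficient of z φ₀(z³) vanishes at a = √3, so V is a function of z³. -/
theorem V_sqrt_three_mul {c : ℂ} (hc : c ^ 3 = 1) (z : ℂ) : V √3 (c * z) = V √3 z := by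
  have h : √3 * ai0' + bi0' = 0 := by rw [bi0'_eq]; ring
  simp only [V_eq, h, mul_pow, hc, one_mul, Complex.ofReal_zero, zero_mul]

/-- At a = -√3 only the term z φ₀(z³) survives. -/
theorem V_neg_sqrt_three_mul {c : ℂ} (hc : c ^ 3 = 1) (z : ℂ) :
    V (-√3) (c * z) = c * V (-√3) z := by
  have h : -√3 * ai0 + bi0 = 0 := by rw [bi0_eq]; ring
  simp only [V_eq, h, mul_pow, hc, one_mul, Complex.ofReal_zero, zero_mul, zero_add]
  ring

theorem ne_zero_of_cube_eq_one {c : ℂ} (hc : c ^ 3 = 1) : c ≠ 0 := by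
  rintro rfl
  norm_num at hc

theorem deriv_V_sqrt_three_mul {c : ℂ} (hc : c ^ 3 = 1) (z : ℂ) :
    c * deriv (V √3) (c * z) = deriv (V √3) z := by
  have h := ((isAirySolution_V √3).hasDerivAt (c * z)).comp z ((hasDerivAt_id z).const_mul c)
  have e : V √3 ∘ (HMul.hMul c) = V √3 := funext fun y => V_sqrt_three_mul hc y
  rw [e] at h
  rw [h.deriv]
  ring

theorem deriv_V_neg_sqrt_three_mul {c : ℂ} (hc : c ^ 3 = 1) (z : ℂ) :
    deriv (V (-√3)) (c * z) = deriv (V (-√3)) z := by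
  have h := ((isAirySolution_V (-√3)).hasDerivAt (c * z)).comp z ((hasDerivAt_id z).const_mul c)
  have e : V (-√3) ∘ (HMul.hMul c) = fun y => c * V (-√3) y :=
    funext fun y => V_neg_sqrt_three_mul hc y
  rw [e] at h
  have h2 := h.unique (((isAirySolution_V (-√3)).hasDerivAt z).const_mul c)
  refine mul_left_cancel₀ (ne_zero_of_cube_eq_one hc) ?_
  rw [← h2]
  ring

theorem nonrealZerosApproachRays_of {f : ℂ → ℂ}
    (hconj : ∀ z, f (starRingEnd ℂ z) = starRingEnd ℂ (f z))
    (h : ∀ ε > 0, ∃ R : ℝ, ∀ z : ℂ, R < ‖z‖ → 0 < z.im → f z = 0 →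
      ∃ r : ℝ, 0 ≤ r ∧ ‖z - r * dir‖ < ε) : NonrealZerosApproachRays f := by
  intro ε hε
  obtain ⟨R, hR⟩ := h ε hε
  refine ⟨R, fun z hz hzR => ⟨fun him => ?_, fun him => ?_⟩⟩
  · obtain ⟨r, hr, hlt⟩ := hR z hzR him hz
    refine (Metric.infDist_le_dist_of_mem (show (r : ℂ) * Complex.exp (((Real.pi / 3 : ℝ) : ℂ) * Complex.I) ∈ ray _
      from ⟨r, hr, rfl⟩)).trans_lt ?_
    rwa [dist_eq_norm]
  · obtain ⟨r, hr, hlt⟩ := hR (starRingEnd ℂ z) (by rwa [RCLike.norm_conj]) (by simpa using him)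
      (by rw [hconj, hz, map_zero])
    refine (Metric.infDist_le_dist_of_mem (show (r : ℂ) * Complex.exp (((-(Real.pi / 3) : ℝ) : ℂ) * Complex.I) ∈ ray _
      from ⟨r, hr, rfl⟩)).trans_lt ?_
    rw [dist_eq_norm, ← RCLike.norm_conj]
    have e : starRingEnd ℂ (Complex.exp (((-(Real.pi / 3) : ℝ) : ℂ) * Complex.I)) = dir := by
      rw [← Complex.exp_conj, map_mul, Complex.conj_ofReal, Complex.conj_I, dir]
      push_cast
      ring_nf
    rwa [map_sub, map_mul, Complex.conj_ofReal, e]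

theorem nonrealZerosApproachRays_V (a : ℝ) : NonrealZerosApproachRays (V a) :=
  nonrealZerosApproachRays_of (V_conj a) fun ε hε => by
    obtain ⟨R, hR⟩ := (isNonrecessive_V a).exists_norm_sub_lt_of_zero hε
    exact ⟨R, fun z hz him h => hR z hz (re_pos_of_zero him (Or.inl h)) him (Or.inl h)⟩

theorem nonrealZerosApproachRays_deriv_V (a : ℝ) : NonrealZerosApproachRays (deriv (V a)) :=
  nonrealZerosApproachRays_of (deriv_V_conj a) fun ε hε => by
    obtain ⟨R, hR⟩ := (isNonrecessive_V a).exists_norm_sub_lt_of_zero hε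
    exact ⟨R, fun z hz him h => hR z hz (re_pos_of_zero him (Or.inr h)) him (Or.inr h)⟩

theorem arg_mem_of_three_lt {a : ℝ} (ha : 3 < a ^ 2) {z : ℂ} (hz : 0 < z.im)
    (h : V a z = 0 ∨ deriv (V a) z = 0) : z.arg ∈ Ioo 0 (Real.pi / 3) :=
  ⟨(arg_mem_of_zero hz h).1,
    lt_of_le_of_ne (arg_le_pi_div_three_of_zero ha.le hz h)
      (arg_ne_pi_div_three_of_zero ha.ne' hz h)⟩

theorem arg_mem_of_lt_three {a : ℝ} (ha : a ^ 2 < 3) {z : ℂ} (hz : 0 < z.im)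
    (h : V a z = 0 ∨ deriv (V a) z = 0) : z.arg ∈ Ioo (Real.pi / 3) (Real.pi / 2) :=
  ⟨lt_of_le_of_ne (pi_div_three_le_arg_of_zero ha.le hz h)
      (arg_ne_pi_div_three_of_zero ha.ne hz h).symm, (arg_mem_of_zero hz h).2⟩

theorem arg_eq_of_eq_three {a : ℝ} (ha : a ^ 2 = 3) {z : ℂ} (hz : 0 < z.im)
    (h : V a z = 0 ∨ deriv (V a) z = 0) : z.arg = Real.pi / 3 :=
  le_antisymm (arg_le_pi_div_three_of_zero ha.ge hz h) (pi_div_three_le_arg_of_zero ha.le hz h)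

theorem V_sqrt_three : V √3 = Uplus := rfl

theorem V_neg_sqrt_three : V (-√3) = Uminus := by
  funext z
  simp [V, Uminus]

end Airy

theorem lemmaA1 :
    -- the case `a > √3`
    (∀ a : ℝ, √3 < a →
      Airy.SectorZeroPattern (Airy.V a) 0 (Real.pi / 3) ∅ ∧
      ∃ x : ℝ, 0 < x ∧
        Airy.SectorZeroPattern (deriv (Airy.V a)) 0 (Real.pi / 3) {(x : ℂ)}) ∧
    -- the case `a = √3`
    (Airy.V (√3) = Airy.Uplus ∧
      Airy.RayZeroPattern Airy.Uplus ∅ ∧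
      Airy.RayZeroPattern (deriv Airy.Uplus) {0}) ∧
    -- the case `-√3 < a < √3`
    (∀ a : ℝ, -√3 < a → a < √3 →
      Airy.SectorZeroPattern (Airy.V a) (Real.pi / 3) (Real.pi / 2) ∅ ∧
      Airy.SectorZeroPattern (deriv (Airy.V a)) (Real.pi / 3) (Real.pi / 2) ∅) ∧
    -- the case `a = -√3`
    (Airy.V (-√3) = Airy.Uminus ∧
      Airy.RayZeroPattern Airy.Uminus {0} ∧
      Airy.RayZeroPattern (deriv Airy.Uminus) ∅) ∧
    -- the case `a < -√3`
    (∀ a : ℝ, a < -√3 →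
      (∃ x : ℝ, 0 < x ∧ Airy.SectorZeroPattern (Airy.V a) 0 (Real.pi / 3) {(x : ℂ)}) ∧
      Airy.SectorZeroPattern (deriv (Airy.V a)) 0 (Real.pi / 3) ∅) ∧
    -- multiplicities
    (∀ (a : ℝ) (z : ℂ), Airy.V a z = 0 → analyticOrderAt (Airy.V a) z = 1) ∧
    (∀ (a : ℝ) (z : ℂ), deriv (Airy.V a) z = 0 → ¬(a = √3 ∧ z = 0) →
      analyticOrderAt (deriv (Airy.V a)) z = 1) ∧
    analyticOrderAt (deriv Airy.Uplus) 0 = 2 ∧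
    -- asymptotic directions of the non-real zeros
    (∀ a : ℝ, Airy.NonrealZerosApproachRays (Airy.V a) ∧
      Airy.NonrealZerosApproachRays (deriv (Airy.V a))) := by
  have h3 : √(3 : ℝ) ^ 2 = 3 := Real.sq_sqrt (by norm_num)
  have h3p : 0 < √(3 : ℝ) := by positivity
  have h3n : (-√(3 : ℝ)) ^ 2 = 3 := by rw [neg_sq, h3]
  have hx1 : ∀ x : ℝ, 0 < x → ∀ z ∈ ({(x : ℂ)} : Set ℂ), z.im = 0 ∧ 0 ≤ z.re := by
    rintro x hx z rfl
    simp [hx.le]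
  have hx0 : ∀ z ∈ ({0} : Set ℂ), z.im = 0 ∧ 0 ≤ z.re := by
    rintro z rfl
    simp
  have hxe : ∀ z ∈ (∅ : Set ℂ), z.im = 0 ∧ 0 ≤ z.re := fun z hz => hz.elim
  refine ⟨fun a ha => ?_, ⟨Airy.V_sqrt_three, ?_, ?_⟩, fun a ha1 ha2 => ?_,
    ⟨Airy.V_neg_sqrt_three, ?_, ?_⟩, fun a ha => ?_, fun a z => Airy.analyticOrderAt_V,
    fun a z => Airy.analyticOrderAt_deriv_V, Airy.analyticOrderAt_deriv_V_sqrt_three,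
    fun a => ⟨Airy.nonrealZerosApproachRays_V a, Airy.nonrealZerosApproachRays_deriv_V a⟩⟩
  · have ha2 : 3 < a ^ 2 := by nlinarith
    obtain ⟨x, hx, hd, hV⟩ := Airy.exists_pos_deriv_zero ha
    refine ⟨Airy.sectorZeroPattern_of (Airy.V_conj a) (Airy.negZeros_V_infinite a)
      (Airy.isNonrecessive_V a).infinite_zeros
      (fun z hz h => Airy.arg_mem_of_three_lt ha2 hz (Or.inl h))
      (fun y hy => by simpa using hV y hy) hxe, x, hx,
      Airy.sectorZeroPattern_of (Airy.deriv_V_conj a) (Airy.negZeros_deriv_V_infinite a)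
      (Airy.isNonrecessive_V a).infinite_zeros_deriv
      (fun z hz h => Airy.arg_mem_of_three_lt ha2 hz (Or.inr h))
      (fun y hy => by simpa using hd y hy) (hx1 x hx)⟩
  · rw [← Airy.V_sqrt_three]
    refine Airy.rayZeroPattern_of (Airy.V_conj _) (Airy.negZeros_V_infinite _)
      (fun c hc z => by rw [Airy.V_sqrt_three_mul hc])
      (fun z hz h => Airy.arg_eq_of_eq_three h3 hz (Or.inl h)) (fun y hy => ?_) hxe
    simp only [Set.mem_empty_iff_false, iff_false]
    rcases hy.eq_or_lt with rfl | hy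
    · rw [Complex.ofReal_zero, Airy.V_zero_eq_zero_iff]
      linarith
    · exact Airy.V_ofReal_ne_zero h3.le hy
  · rw [← Airy.V_sqrt_three]
    refine Airy.rayZeroPattern_of (Airy.deriv_V_conj _) (Airy.negZeros_deriv_V_infinite _)
      (fun c hc z => by
        rw [← Airy.deriv_V_sqrt_three_mul hc z, mul_eq_zero,
          or_iff_right (Airy.ne_zero_of_cube_eq_one hc)])
      (fun z hz h => Airy.arg_eq_of_eq_three h3 hz (Or.inr h)) (fun y hy => ?_) hx0
    rw [Set.mem_singleton_iff, Complex.ofReal_eq_zero]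
    rcases hy.eq_or_lt with rfl | hy
    · rw [Complex.ofReal_zero, Airy.deriv_V_zero_eq_zero_iff]
      simp
    · exact iff_of_false (Airy.deriv_V_ofReal_ne_zero h3.le hy) hy.ne'
  · have ha : a ^ 2 < 3 := by nlinarith
    refine ⟨Airy.sectorZeroPattern_of (Airy.V_conj a) (Airy.negZeros_V_infinite a)
      (Airy.isNonrecessive_V a).infinite_zeros
      (fun z hz h => Airy.arg_mem_of_lt_three ha hz (Or.inl h)) (fun y hy => ?_) hxe,
      Airy.sectorZeroPattern_of (Airy.deriv_V_conj a) (Airy.negZeros_deriv_V_infinite a)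
      (Airy.isNonrecessive_V a).infinite_zeros_deriv
      (fun z hz h => Airy.arg_mem_of_lt_three ha hz (Or.inr h)) (fun y hy => ?_) hxe⟩
    · simp only [Set.mem_empty_iff_false, iff_false]
      rcases hy.eq_or_lt with rfl | hy
      · rw [Complex.ofReal_zero, Airy.V_zero_eq_zero_iff]
        exact ha1.ne'
      · exact Airy.V_ofReal_ne_zero ha.le hy
    · simp only [Set.mem_empty_iff_false, iff_false]
      rcases hy.eq_or_lt with rfl | hy
      · rw [Complex.ofReal_zero, Airy.deriv_V_zero_eq_zero_iff]
        exact ha2.ne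
      · exact Airy.deriv_V_ofReal_ne_zero ha.le hy
  · rw [← Airy.V_neg_sqrt_three]
    refine Airy.rayZeroPattern_of (Airy.V_conj _) (Airy.negZeros_V_infinite _)
      (fun c hc z => by
        rw [Airy.V_neg_sqrt_three_mul hc z, mul_eq_zero,
          or_iff_right (Airy.ne_zero_of_cube_eq_one hc)])
      (fun z hz h => Airy.arg_eq_of_eq_three h3n hz (Or.inl h)) (fun y hy => ?_) hx0
    rw [Set.mem_singleton_iff, Complex.ofReal_eq_zero]
    rcases hy.eq_or_lt with rfl | hy
    · rw [Complex.ofReal_zero, Airy.V_zero_eq_zero_iff]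
      simp
    · exact iff_of_false (Airy.V_ofReal_ne_zero h3n.le hy) hy.ne'
  · rw [← Airy.V_neg_sqrt_three]
    refine Airy.rayZeroPattern_of (Airy.deriv_V_conj _) (Airy.negZeros_deriv_V_infinite _)
      (fun c hc z => by rw [Airy.deriv_V_neg_sqrt_three_mul hc])
      (fun z hz h => Airy.arg_eq_of_eq_three h3n hz (Or.inr h)) (fun y hy => ?_) hxe
    simp only [Set.mem_empty_iff_false, iff_false]
    rcases hy.eq_or_lt with rfl | hy
    · rw [Complex.ofReal_zero, Airy.deriv_V_zero_eq_zero_iff]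
      linarith
    · exact Airy.deriv_V_ofReal_ne_zero h3n.le hy
  · have ha2 : 3 < a ^ 2 := by nlinarith
    obtain ⟨x, hx, hV, hd⟩ := Airy.exists_pos_zero ha
    refine ⟨⟨x, hx, Airy.sectorZeroPattern_of (Airy.V_conj a) (Airy.negZeros_V_infinite a)
      (Airy.isNonrecessive_V a).infinite_zeros
      (fun z hz h => Airy.arg_mem_of_three_lt ha2 hz (Or.inl h))
      (fun y hy => by simpa using hV y hy) (hx1 x hx)⟩,
      Airy.sectorZeroPattern_of (Airy.deriv_V_conj a) (Airy.negZeros_deriv_V_infinite a)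
      (Airy.isNonrecessive_V a).infinite_zeros_deriv
      (fun z hz h => Airy.arg_mem_of_three_lt ha2 hz (Or.inr h))
      (fun y hy => by simpa using hd y hy) hxe⟩
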